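/- Let $\mathbb{Z}^2$ act on $2^{\mathbb{Z}^2}=\{0,1\}^{\mathbb{Z}^2}$ (product topology) by the shift $(g\cdot x)(h)=x(h+g)$, and let $F(2^{\mathbb{Z}^2})=\{x : g\cdot x\neq x \text{ for all } g\neq 0\}$ be its free part, with the subspace topology and the induced action; write $[x]$ for the orbit of $x$. A set $M\subseteq F(2^{\mathbb{Z}^2})$ is a \emph{complete section} if it meets every orbit, and is \emph{co-complete} if its complement in $F(2^{\mathbb{Z}^2})$ meets every orbit. A \emph{continuous subaction} of $\mathbb{Z}^2$ on $M$ is an action $\star$ of $\mathbb{Z}^2$ on $M$ such that (a) for all $y_1,y_2\in M$, there is $h\in\mathbb{Z}^2$ with $h\star y_1=y_2$ if and only if there is $g\in\mathbb{Z}^2$ with $g\cdot y_1=y_2$, and (b) there is a continuous $\varphi:\mathbb{Z}^2\times M\to\mathbb{Z}^2$ with $h\star y=\varphi(h,y)\cdot y$ for all $h\in\mathbb{Z}^2$, $y\in M$. Here $\mathbb{Z}^2$ is discrete and $M$ has the subspace topology. It is \emph{free} if $h\star y\ne y$ for all $h\neq 0$ and $y\in M$. A \emph{rectangular tiling} is an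 equivalence relation $E$ on $F(2^{\mathbb{Z}^2})$, contained in the orbit equivalence relation, such that every $E$-class has the form $([a,b]\times[c,d])\cdot x=\{(i,j)\cdot x: i,j\in\mathbb{Z},\ a\le i\le b,\ c\le j\le d\}$ for some $x$ and integers $a<b$, $c<d$; its side lengths are $b-a+1$ and $d-c+1$. It is \emph{clopen} if $\{x: x\,E\,(g\cdot x)\}$ is clopen in $F(2^{\mathbb{Z}^2})$ for every $g\in\mathbb{Z}^2$. It is \emph{almost lined-up} if there is $M\in\mathbb{N}$ such that all side lengths of all classes are at most $M$ and, for each of the four directions $e\in\{(\pm1,0),(0,\pm1)\}$ and each class $R_1$, there is a class $R_2\neq R_1$, adjacent to $R_1$ in direction $e$ (that is, $e\cdot y\in R_2$ for some $y\in R_1$), whose overlap $|\{y\in R_1: e\cdot y\in R_2\}|$ is greater than $M/2$. Then: (1) There do not exist a clopen, complete, co-complete section $M\subseteq F(2^{\mathbb{Z}^2})$ and a continuous free subaction $\star$ of $\mathbb{Z}^2$ on $M$. (2) There is no clopen rectangular tiling of $F(2^{\mathbb{Z}^2})$ which is almost lined-up. -/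

import Mathlib

/-- The space `2^G` of all functions `G → {0, 1}`. -/
def TwoPow (G : Type*) : Type _ := G → Bool

/-- `2^G` carries the product topology, where `{0, 1}` is discrete. -/
instance (G : Type*) : TopologicalSpace (TwoPow G) :=
  inferInstanceAs (TopologicalSpace (G → Bool))

/-- The (right) shift action of `G` on `2^G`: `(g · x)(h) = x(h + g)`. -/
instance (G : Type*) [AddGroup G] : AddAction G (TwoPow G) where
  vadd g x := fun h => x (h + g)
  zero_vadd x := funext fun h => congrArg x (add_zero h)
  add_vadd g g' x := funext fun h => congrArg x (add_assoc h g g').symm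

theorem TwoPow.vadd_apply {G : Type*} [AddGroup G] (g : G) (x : TwoPow G) (h : G) :
    (g +ᵥ x : TwoPow G) h = x (h + g) := rfl

/-- The free part `F(X)` of an action: the points with trivial stabilizer. -/
def freePart (G X : Type*) [AddGroup G] [AddAction G X] : Set X :=
  {x | ∀ g : G, g ≠ 0 → g +ᵥ x ≠ x}

theorem vadd_mem_freePart {G X : Type*} [AddGroup G] [AddAction G X] (g : G) {x : X}
    (hx : x ∈ freePart G X) : g +ᵥ x ∈ freePart G X := by
  intro k hk h
  refine hx (-g + k + g) ?_ ?_
  · intro h0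
    apply hk
    have h1 : g + (-g + k + g) + -g = k := by simp [add_assoc]
    rw [← h1, h0]
    simp
  · rw [add_vadd, add_vadd, h, neg_vadd_vadd]

/-- The action of `G` restricted to the (invariant) free part. -/
instance (G X : Type*) [AddGroup G] [AddAction G X] : AddAction G (freePart G X) where
  vadd g x := ⟨g +ᵥ (x : X), vadd_mem_freePart g x.2⟩
  zero_vadd x := Subtype.ext (zero_vadd G (x : X))
  add_vadd g g' x := Subtype.ext (add_vadd g g' (x : X))

theorem freePart.coe_vadd {G X : Type*} [AddGroup G] [AddAction G X] (g : G)
    (x : freePart G X) : ((g +ᵥ x : freePart G X) : X) = g +ᵥ (x : X) := rfl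

/-- The group `ℤ²`, written additively, with its discrete topology. -/
abbrev ZSq : Type := ℤ × ℤ

/-- `F(2^{ℤ²})`, the free part of the shift action of `ℤ²` on `2^{ℤ²}`,
with the subspace topology. -/
abbrev FZSq : Type := freePart ZSq (TwoPow ZSq)

/-- `M` is a complete section: it meets every orbit. -/
def IsCompleteSection (G : Type*) {X : Type*} [AddGroup G] [AddAction G X] (M : Set X) : Prop :=
  ∀ x : X, (M ∩ AddAction.orbit G x).Nonempty

/-- `M` is co-complete: its complement is a complete section. -/
def IsCoCompleteSection (G : Type*) {X : Type*} [AddGroup G] [AddAction G X] (M : Set X) : Prop :=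
  IsCompleteSection G Mᶜ

/-- An action `star` of `H` on the subset `Y` of the `G`-space `X` is a subaction if two points
of `Y` are in the same `H`-orbit iff they are in the same `G`-orbit. -/
def IsSubaction {G H X : Type*} [AddGroup G] [AddGroup H] [AddAction G X] (Y : Set X)
    (star : AddAction H Y) : Prop :=
  ∀ y₁ y₂ : Y, (∃ h : H, star.vadd h y₁ = y₂) ↔ ∃ g : G, g +ᵥ (y₁ : X) = (y₂ : X)

/-- A continuous subaction: it is moreover given by a continuous cocycle
`φ : H × Y → G`, where `Y` has the subspace topology. -/
def IsContinuousSubaction {G H X : Type*} [AddGroup G] [AddGroup H] [AddAction G X]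
    [TopologicalSpace G] [TopologicalSpace H] [TopologicalSpace X] (Y : Set X)
    (star : AddAction H Y) : Prop :=
  IsSubaction (G := G) Y star ∧
    ∃ φ : H × Y → G, Continuous φ ∧
      ∀ (h : H) (y : Y), ((star.vadd h y : Y) : X) = φ (h, y) +ᵥ (y : X)

/-- The action `star` of `H` on `Y` is free. -/
def IsFreeAction {H Y : Type*} [AddGroup H] (star : AddAction H Y) : Prop :=
  ∀ h : H, h ≠ 0 → ∀ y : Y, star.vadd h y ≠ y

/-- `R = ([a, b] × [c, d]) · x`, with `a < b` and `c < d`. -/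
def IsRectangleAt (R : Set FZSq) (x : FZSq) (a b c d : ℤ) : Prop :=
  a < b ∧ c < d ∧ R = {y | ∃ i j : ℤ, i ∈ Set.Icc a b ∧ j ∈ Set.Icc c d ∧ y = ((i, j) : ZSq) +ᵥ x}

/-- A rectangular tiling of `F(2^{ℤ²})`: a subequivalence relation of the orbit equivalence
relation each of whose classes is a (finite) rectangle in an orbit. -/
def IsRectangularTiling (E : Setoid FZSq) : Prop :=
  E ≤ AddAction.orbitRel ZSq FZSq ∧
    ∀ R ∈ E.classes, ∃ (x : FZSq) (a b c d : ℤ), IsRectangleAt R x a b c d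

/-- A subequivalence relation `E` of the orbit equivalence relation is clopen if for each
`g ∈ ℤ²` the set of `x` with `x E g · x` is clopen in `F(2^{ℤ²})`. -/
def IsClopenRel (E : Setoid FZSq) : Prop :=
  ∀ g : ZSq, IsClopen {x : FZSq | E x (g +ᵥ x)}

/-- All side lengths (counted in points) of the rectangles of the tiling are at most `M`. -/
def SideLengthsLE (E : Setoid FZSq) (M : ℕ) : Prop :=
  ∀ R ∈ E.classes, ∀ (x : FZSq) (a b c d : ℤ), IsRectangleAt R x a b c d →
    b - a + 1 ≤ M ∧ d - c + 1 ≤ M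

/-- `R₂` is adjacent to `R₁` in the direction of the generator `e`: the two (different)
rectangles have points `y ∈ R₁` and `e · y ∈ R₂`. -/
def IsAdjacentInDirection (e : ZSq) (R₁ R₂ : Set FZSq) : Prop :=
  R₁ ≠ R₂ ∧ ∃ y ∈ R₁, e +ᵥ y ∈ R₂

/-- The overlap of `R₁` and `R₂` in the direction of the generator `e`: the number of points
`y ∈ R₁` with `e · y ∈ R₂`. -/
noncomputable def overlap (e : ZSq) (R₁ R₂ : Set FZSq) : ℕ :=
  Set.ncard {y ∈ R₁ | e +ᵥ y ∈ R₂}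

/-- The tiling `E`, with side lengths bounded by some `M`, is almost lined-up: each rectangle
has in each of the four directions (right, left, top, bottom) an adjacent rectangle with
overlap greater than `M / 2`. -/
def IsAlmostLinedUp (E : Setoid FZSq) : Prop :=
  ∃ M : ℕ, SideLengthsLE E M ∧
    ∀ e ∈ ({(1, 0), (-1, 0), (0, 1), (0, -1)} : Set ZSq), ∀ R₁ ∈ E.classes, ∃ R₂ ∈ E.classes,
      IsAdjacentInDirection e R₁ R₂ ∧ (M : ℝ) / 2 < (overlap e R₁ R₂ : ℝ)

/-! For (1): sending each point continuously to a point of `M` in its orbit turns the subaction into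
a continuous cocycle `σ` on the whole free part. On a compact invariant set, the increments of `σ`
depend only on a window of fixed radius `W`. The test points are arrays that are `p`-periodic in the
lower left quadrant of a large box and `q`-periodic in the rest of it, with `p = n + 2` and `q = n +
3`. One compact invariant set contains them all (`exists_compact_twoPeriodArray`), so `W` and the
bounds on displacements do not depend on `n`.

A vertical shift by `p` inside the quadrant changes `σ` by a constant `C`, and a shift by `q` in the
lower right quadrant by a constant `D`. A shift by `p * q` is a period on both sides and changes `σ`
by the same amount on each, so `q • C = p • D`, and coprimality makes `C` divisible by `p`. By
symmetry, points congruent mod `p` have `σ`-values congruent mod `p`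
(`HasLocalGradient.exists_eq_smul`). The `p²` points `(a, b) ⋆ y₀` with `0 ≤ a, b < p` have pairwise
incongruent `σ`-values, hence pairwise incongruent positions, so they meet every residue class.
Membership in `M` is local, hence `p`-periodic, so the inner part of the quadrant lies in `M`;
co-completeness forbids this.

For (2): overlaps above half the maximal side make neighbours unique, and going right then up agrees
with going up then right (`IsLinedUpTiling.comm`). The two neighbour maps thus generate a
`ℤ²`-action on the clopen set of lower left corners. It is free because each step moves farther
along its own direction than sideways, and transitive on the corners of an orbit because touching
tiles are linked by neighbour steps (`IsLinedUpTiling.forall_of_invariant`). This contradicts (1).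
-/

/-! ### A uniformly aperiodic array. -/

/-- The parity of the `2`-adic valuation of an integer. -/
def ruler (i : ℤ) : Bool := decide (Odd (padicValInt 2 i))

theorem padicValInt_two_eq (m : ℕ) (t : ℤ) : padicValInt 2 (2 ^ m * (2 * t + 1)) = m := by
  have h1 : (2 * t + 1 : ℤ) ≠ 0 := by omega
  have h2 : ((2 : ℤ) ^ m) ≠ 0 := by positivity
  rw [padicValInt.mul h2 h1, padicValInt.eq_zero_of_not_dvd (z := 2 * t + 1) (by omega)]
  simp [padicValInt, Int.natAbs_pow]

theorem exists_mem_window_add_mul (m : ℤ) (hm : 0 < m) (a c : ℤ) :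
    ∃ t : ℤ, c ≤ a + m * t ∧ a + m * t < c + m := by
  refine ⟨-((a - c) / m), ?_, ?_⟩
  · have := Int.mul_ediv_self_le (x := a - c) (k := m) hm.ne'
    linarith
  · have := Int.lt_mul_ediv_self_add (x := a - c) hm
    linarith

/-- Let `k` be the `2`-adic valuation of `g`. If `i` has valuation `k + 1` or `k + 2`, then `i + g`
has valuation `k`, so the two kinds of `i` give different values of the xor. Both kinds occur in
every window of length `2 ^ (k + 3)`. -/
theorem ruler_xor_not_constant (g : ℤ) (hg : g ≠ 0) :
    ∃ N : ℕ, ∀ c : ℤ, ∃ i i' : ℤ, (c ≤ i ∧ i < c + N) ∧ (c ≤ i' ∧ i' < c + N) ∧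
      (ruler (i + g) ^^ ruler i) ≠ (ruler (i' + g) ^^ ruler i') := by
  obtain ⟨k, r, hr, rfl⟩ : ∃ (k : ℕ) (r : ℤ), ¬ (2 : ℤ) ∣ r ∧ g = 2 ^ k * r := by
    have hfin : FiniteMultiplicity (2 : ℤ) g :=
      Int.finiteMultiplicity_iff.2 ⟨by decide, hg⟩
    obtain ⟨r, h1, h2⟩ := hfin.exists_eq_pow_mul_and_not_dvd
    exact ⟨_, r, h2, h1⟩
  obtain ⟨s, rfl⟩ : ∃ s, r = 2 * s + 1 := ⟨r / 2, by omega⟩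
  refine ⟨2 ^ (k + 3), fun c => ?_⟩
  obtain ⟨t, ht⟩ := exists_mem_window_add_mul (2 ^ (k + 3)) (by positivity) (2 ^ (k + 1)) c
  obtain ⟨t', ht'⟩ := exists_mem_window_add_mul (2 ^ (k + 3)) (by positivity) (2 ^ (k + 2)) c
  refine ⟨_, _, by exact_mod_cast ht, by exact_mod_cast ht', ?_⟩
  have e1 : (2 : ℤ) ^ (k + 1) + 2 ^ (k + 3) * t = 2 ^ (k + 1) * (2 * (2 * t) + 1) := by ring
  have e2 : (2 : ℤ) ^ (k + 1) + 2 ^ (k + 3) * t + 2 ^ k * (2 * s + 1)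
      = 2 ^ k * (2 * (s + 1 + 4 * t) + 1) := by ring
  have e3 : (2 : ℤ) ^ (k + 2) + 2 ^ (k + 3) * t' = 2 ^ (k + 2) * (2 * t' + 1) := by ring
  have e4 : (2 : ℤ) ^ (k + 2) + 2 ^ (k + 3) * t' + 2 ^ k * (2 * s + 1)
      = 2 ^ k * (2 * (s + 2 + 4 * t') + 1) := by ring
  push_cast
  rw [e2, e4, e1, e3]
  simp only [ruler, padicValInt_two_eq]
  rcases Nat.even_or_odd k with h | h
  · simp [Nat.odd_add_one, h, parity_simps, Nat.not_odd_iff_even.2 h]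
  · simp [Nat.odd_add_one, h, parity_simps]

/-- A doubly infinite array without local periods. -/
def aperiodicArray (i j : ℤ) : Bool := ruler i ^^ ruler j

/-- Along a line in a direction where `g` is nonzero, the xor of the array with its translate is the
one-dimensional xor plus a constant. The former is not constant on windows, so the two arrays differ
somewhere. -/
theorem aperiodicArray_violation (g : ℤ × ℤ) (hg : g ≠ 0) :
    ∃ N : ℕ, ∀ s t : ℤ, ∃ i j : ℤ, (s ≤ i ∧ i < s + N) ∧ (t ≤ j ∧ j < t + N) ∧
      aperiodicArray (i + g.1) (j + g.2) ≠ aperiodicArray i j := by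
  obtain ⟨g, g'⟩ := g
  by_cases h : g = 0
  · have h' : g' ≠ 0 := by
      rintro rfl
      exact hg (by simp [h])
    obtain ⟨N, hN⟩ := ruler_xor_not_constant g' h'
    refine ⟨N, fun s t => ?_⟩
    obtain ⟨j, j', hj, hj', hne⟩ := hN t
    by_cases h1 : aperiodicArray (s + g) (j + g') = aperiodicArray s j
    · refine ⟨s, j', ⟨le_rfl, by omega⟩, hj', fun h2 => hne ?_⟩
      simp only [aperiodicArray, h, add_zero] at h1 h2
      revert h1 h2
      cases ruler s <;> cases ruler j <;> cases ruler j' <;> cases ruler (j + g') <;>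
        cases ruler (j' + g') <;> simp
    · exact ⟨s, j, ⟨le_rfl, by omega⟩, hj, h1⟩
  · obtain ⟨N, hN⟩ := ruler_xor_not_constant g h
    refine ⟨N, fun s t => ?_⟩
    obtain ⟨i, i', hi, hi', hne⟩ := hN s
    by_cases h1 : aperiodicArray (i + g) (t + g') = aperiodicArray i t
    · refine ⟨i', t, hi', ⟨le_rfl, by omega⟩, fun h2 => hne ?_⟩
      simp only [aperiodicArray] at h1 h2
      revert h1 h2
      cases ruler t <;> cases ruler (t + g') <;> cases ruler i <;> cases ruler i' <;>
        cases ruler (i + g) <;> cases ruler (i' + g) <;> simp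
    · exact ⟨i, t, hi, ⟨le_rfl, by omega⟩, h1⟩

/-! ### The two-period arrays and their uniform aperiodicity. -/

/-- The array which agrees with `aperiodicArray` outside of the box `[-S, S)²`, is `p`-periodic in
both directions in the lower left quadrant of the box, and `q`-periodic in the rest of the box. -/
def boxArray (p q S : ℤ) (i j : ℤ) : Bool :=
  if (-S ≤ i ∧ i < S) ∧ (-S ≤ j ∧ j < S) then
    if i < 0 ∧ j < 0 then aperiodicArray (i % p) (j % p) else aperiodicArray (i % q) (j % q)
  else aperiodicArray i j

/-- On an interval of length `3 * L` each of the two quotients jumps at most once, so one of three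
consecutive blocks of length `L` contains no jump. -/
theorem exists_subinterval_ediv_constant (p q L s : ℤ) (hL : 0 < L) (hp : 3 * L ≤ p)
    (hq : 3 * L ≤ q) :
    ∃ s' a b : ℤ, s ≤ s' ∧ s' + L ≤ s + 3 * L ∧
      ∀ i, s' ≤ i → i < s' + L → i / p = a ∧ i / q = b := by
  have key : ∀ p : ℤ, 3 * L ≤ p → s / p ≤ (s + L - 1) / p ∧ (s + L - 1) / p ≤ (s + L) / p ∧
      (s + L) / p ≤ (s + L + L - 1) / p ∧ (s + L + L - 1) / p ≤ (s + L + L) / p ∧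
      (s + L + L) / p ≤ (s + L + L + L - 1) / p ∧ (s + L + L + L - 1) / p ≤ s / p + 1 := by
    intro p hp
    have hp0 : 0 < p := by omega
    refine ⟨Int.ediv_le_ediv hp0 (by omega), Int.ediv_le_ediv hp0 (by omega),
      Int.ediv_le_ediv hp0 (by omega), Int.ediv_le_ediv hp0 (by omega),
      Int.ediv_le_ediv hp0 (by omega), ?_⟩
    have : s / p + 1 = (s + 1 * p) / p := by rw [Int.add_mul_ediv_right _ _ hp0.ne']
    rw [this]
    exact Int.ediv_le_ediv hp0 (by omega)
  have main : ∀ s', s ≤ s' → s' + L ≤ s + 3 * L → s' / p = (s' + L - 1) / p →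
      s' / q = (s' + L - 1) / q → ∃ s' a b : ℤ, s ≤ s' ∧ s' + L ≤ s + 3 * L ∧
      ∀ i, s' ≤ i → i < s' + L → i / p = a ∧ i / q = b := by
    intro s' h1 h2 h3 h4
    refine ⟨s', s' / p, s' / q, h1, h2, fun i hi hi' => ⟨?_, ?_⟩⟩
    · exact le_antisymm (h3 ▸ Int.ediv_le_ediv (by omega) (by omega))
        (Int.ediv_le_ediv (by omega) (by omega))
    · exact le_antisymm (h4 ▸ Int.ediv_le_ediv (by omega) (by omega))
        (Int.ediv_le_ediv (by omega) (by omega))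
  have hkp := key p hp
  have hkq := key q hq
  by_cases h0 : s / p = (s + L - 1) / p ∧ s / q = (s + L - 1) / q
  · exact main s (by omega) (by omega) h0.1 h0.2
  by_cases h1 : (s + L) / p = (s + L + L - 1) / p ∧ (s + L) / q = (s + L + L - 1) / q
  · exact main (s + L) (by omega) (by omega) h1.1 h1.2
  exact main (s + L + L) (by omega) (by omega) (by omega) (by omega)

/-- The half side `p * m` is a multiple of `p`, so a block with constant quotients by `p` lies on
one side of every dividing line. On it a residue mod `p` or `q` is a fixed translation. -/
theorem boxArray_eq_translate (p q m L s t : ℤ) (hL : 0 < L) (hp : 3 * L ≤ p)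
    (hq : 3 * L ≤ q) :
    ∃ s' t' i₀ j₀ : ℤ, (s ≤ s' ∧ s' + L ≤ s + 3 * L) ∧ (t ≤ t' ∧ t' + L ≤ t + 3 * L) ∧
      ∀ i j, s' ≤ i → i < s' + L → t' ≤ j → j < t' + L →
        boxArray p q (p * m) i j = aperiodicArray (i + i₀) (j + j₀) := by
  obtain ⟨s', a, b, hs, hs', hi⟩ := exists_subinterval_ediv_constant p q L s hL hp hq
  obtain ⟨t', a', b', ht, ht', hj⟩ := exists_subinterval_ediv_constant p q L t hL hp hq
  have hp0 : 0 < p := by omega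
  have hbox : ∀ i : ℤ, (-(p * m) ≤ i ∧ i < p * m) ↔ (-m ≤ i / p ∧ i / p < m) := by
    intro i
    rw [Int.le_ediv_iff_mul_le hp0, Int.ediv_lt_iff_lt_mul hp0]
    constructor <;> rintro ⟨h1, h2⟩ <;> constructor <;> linarith
  have hneg : ∀ i : ℤ, i < 0 ↔ i / p < 0 := by
    intro i
    rw [Int.ediv_lt_iff_lt_mul hp0, zero_mul]
  by_cases h1 : (-m ≤ a ∧ a < m) ∧ (-m ≤ a' ∧ a' < m)
  · by_cases h2 : a < 0 ∧ a' < 0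
    · refine ⟨s', t', -(p * a), -(p * a'), ⟨hs, hs'⟩, ⟨ht, ht'⟩, fun i j hi1 hi2 hj1 hj2 => ?_⟩
      have hi := hi i hi1 hi2
      have hj := hj j hj1 hj2
      rw [boxArray, if_pos (by rwa [hbox, hbox, hi.1, hj.1]),
        if_pos (by rwa [hneg i, hneg j, hi.1, hj.1]), Int.emod_def, Int.emod_def, hi.1, hj.1,
        sub_eq_add_neg, sub_eq_add_neg]
    · refine ⟨s', t', -(q * b), -(q * b'), ⟨hs, hs'⟩, ⟨ht, ht'⟩, fun i j hi1 hi2 hj1 hj2 => ?_⟩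
      have hi := hi i hi1 hi2
      have hj := hj j hj1 hj2
      rw [boxArray, if_pos (by rwa [hbox, hbox, hi.1, hj.1]),
        if_neg (by rwa [hneg i, hneg j, hi.1, hj.1]), Int.emod_def, Int.emod_def, hi.2, hj.2,
        sub_eq_add_neg, sub_eq_add_neg]
  · refine ⟨s', t', 0, 0, ⟨hs, hs'⟩, ⟨ht, ht'⟩, fun i j hi1 hi2 hj1 hj2 => ?_⟩
    have hi := hi i hi1 hi2
    have hj := hj j hj1 hj2
    rw [boxArray, if_neg (by rwa [hbox, hbox, hi.1, hj.1]), add_zero, add_zero]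

/-- The array with periods `n + 2` and `n + 3` in a box of half side `((n + 2) (n + 3))²`. -/
def twoPeriodArray (n : ℕ) : ℤ → ℤ → Bool :=
  boxArray (n + 2) (n + 3) ((n + 2) * ((n + 2) * (n + 3) ^ 2))

theorem twoPeriodArray_eq_translate (L : ℕ) (hL : 0 < L) :
    ∃ N : ℕ, ∀ (n : ℕ) (s t : ℤ), ∃ s' t' i₀ j₀ : ℤ,
      (s ≤ s' ∧ s' + L ≤ s + N) ∧ (t ≤ t' ∧ t' + L ≤ t + N) ∧
      ∀ i j, s' ≤ i → i < s' + L → t' ≤ j → j < t' + L →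
        twoPeriodArray n i j = aperiodicArray (i + i₀) (j + j₀) := by
  obtain ⟨B, hB⟩ : ∃ B : ℕ, B = (3 * L + 2) * ((3 * L + 2) * (3 * L + 3) ^ 2) := ⟨_, rfl⟩
  refine ⟨3 * L + 2 * B, fun n s t => ?_⟩
  rcases le_or_gt (3 * L) n with h | h
  · obtain ⟨s', t', i₀, j₀, hs, ht, H⟩ := boxArray_eq_translate (n + 2) (n + 3)
      ((n + 2) * (n + 3) ^ 2) L s t (by omega) (by omega) (by omega)
    exact ⟨s', t', i₀, j₀, ⟨hs.1, by push_cast; omega⟩, ⟨ht.1, by push_cast; omega⟩, H⟩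
  -- For the finitely many small `n` all boxes lie in `[-B, B)²`, and the extra width `2 * B` leaves
  -- room for a block beside the box.
  · obtain ⟨S, hS⟩ : ∃ S : ℕ, S = (n + 2) * ((n + 2) * (n + 3) ^ 2) := ⟨_, rfl⟩
    have hSB : S ≤ B := by rw [hS, hB]; gcongr
    have hout : ∀ s' : ℤ, (s' + L ≤ -S ∨ S ≤ s') → ∀ i j, s' ≤ i → i < s' + L → t ≤ j →
        j < t + L → twoPeriodArray n i j = aperiodicArray (i + 0) (j + 0) := by
      intro s' hs' i j hi hi' _ _
      have hS' : ((n : ℤ) + 2) * ((n + 2) * (n + 3) ^ 2) = S := by rw [hS]; push_cast; ring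
      rw [twoPeriodArray, boxArray, hS', if_neg (by omega), add_zero, add_zero]
    by_cases h1 : s + L ≤ -S ∨ S ≤ s
    · exact ⟨s, t, 0, 0, by push_cast; omega, by push_cast; omega, hout s h1⟩
    · exact ⟨S, t, 0, 0, by push_cast; omega, by push_cast; omega, hout S (Or.inr le_rfl)⟩

theorem twoPeriodArray_violation (g : ℤ × ℤ) (hg : g ≠ 0) :
    ∃ N : ℕ, ∀ (n : ℕ) (s t : ℤ), ∃ i j : ℤ, (s ≤ i ∧ i < s + N) ∧ (t ≤ j ∧ j < t + N) ∧
      twoPeriodArray n (i + g.1) (j + g.2) ≠ twoPeriodArray n i j := by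
  obtain ⟨N₀, hN₀⟩ := aperiodicArray_violation g hg
  set G : ℕ := g.1.natAbs + g.2.natAbs with hG
  -- The margin `G` on each side keeps the violating point and its translate by `g` in the same
  -- block.
  obtain ⟨N, hN⟩ := twoPeriodArray_eq_translate (N₀ + 2 * G + 1) (by omega)
  refine ⟨N, fun n s t => ?_⟩
  obtain ⟨s', t', i₀, j₀, hs, ht, H⟩ := hN n s t
  obtain ⟨i, j, hi, hj, hne⟩ := hN₀ (s' + G + i₀) (t' + G + j₀)
  push_cast at hs ht H
  refine ⟨i - i₀, j - j₀, by omega, by omega, ?_⟩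
  rw [H _ _ (by omega) (by omega) (by omega) (by omega),
    H _ _ (by omega) (by omega) (by omega) (by omega)]
  convert hne using 2 <;> ring

theorem boxArray_swap (p q S i j : ℤ) : boxArray p q S i j = boxArray p q S j i := by
  have h : ∀ i j, aperiodicArray i j = aperiodicArray j i := fun i j => Bool.xor_comm _ _
  simp only [boxArray, h i j, h (i % p), h (i % q)]
  congr 1
  · rw [and_comm]
  · simp only [and_comm]

theorem boxArray_periodic_left {p q S i j j' : ℤ} (hi : -S ≤ i) (hi' : i < 0) (hj : -S ≤ j)
    (hj0 : j < 0) (hj' : -S ≤ j') (hj0' : j' < 0) (h : j ≡ j' [ZMOD p]) :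
    boxArray p q S i j = boxArray p q S i j' := by
  rw [boxArray, boxArray, if_pos (by omega), if_pos (by omega), if_pos (by omega),
    if_pos (by omega), h]

theorem boxArray_periodic_right {p q S i j j' : ℤ} (hi : 0 ≤ i) (hi' : i < S) (hj : -S ≤ j)
    (hj0 : j < 0) (hj' : -S ≤ j') (hj0' : j' < 0) (h : j ≡ j' [ZMOD q]) :
    boxArray p q S i j = boxArray p q S i j' := by
  rw [boxArray, boxArray, if_pos (by omega), if_neg (by omega), if_pos (by omega),
    if_neg (by omega), h]

/-! ### Functions with local gradient on a two-period array. -/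

theorem eq_of_forall_succ_eq {A : Type*} {g : ℤ → A} {lo hi : ℤ}
    (h : ∀ i, lo ≤ i → i < hi → g (i + 1) = g i) {i : ℤ} (h1 : lo ≤ i) (h2 : i ≤ hi) :
    g i = g lo := by
  induction i, h1 using Int.leInduction with
  | base => rfl
  | succ i hi' ih => rw [h i hi' (by omega), ih (by omega)]

theorem sub_eq_nsmul_of_forall_sub_eq {A : Type*} [AddCommGroup A] {g : ℤ → A} {lo hi p : ℤ}
    (hp : 0 ≤ p) {C : A} (h : ∀ j, lo ≤ j → j + p ≤ hi → g (j + p) - g j = C) {j : ℤ} (n : ℕ)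
    (h1 : lo ≤ j) (h2 : j + n * p ≤ hi) : g (j + n * p) - g j = n • C := by
  induction n with
  | zero => simp
  | succ n ih =>
    have e : j + ((n + 1 : ℕ) : ℤ) * p = j + n * p + p := by push_cast; ring
    have h0 : 0 ≤ (n : ℤ) * p := by positivity
    rw [e] at h2 ⊢
    have := h (j + n * p) (by omega) h2
    rw [← sub_add_sub_cancel _ (g (j + n * p)), this, ih (by omega), succ_nsmul, add_comm]

/-- The gradient of `f` at a point only depends on the values of the array `x` in the square of
radius `W` around that point. -/
def HasLocalGradient {A : Type*} [AddCommGroup A] (W : ℕ) (x : ℤ → ℤ → Bool) (f : ℤ → ℤ → A) :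
    Prop :=
  ∀ i j i' j' : ℤ, (∀ s t : ℤ, |s| ≤ W → |t| ≤ W → x (i + s) (j + t) = x (i' + s) (j' + t)) →
    f (i + 1) j - f i j = f (i' + 1) j' - f i' j' ∧
      f i (j + 1) - f i j = f i' (j' + 1) - f i' j'

theorem HasLocalGradient.swap {A : Type*} [AddCommGroup A] {W : ℕ} {x : ℤ → ℤ → Bool}
    {f : ℤ → ℤ → A} (h : HasLocalGradient W x f) :
    HasLocalGradient W (fun i j => x j i) (fun i j => f j i) :=
  fun i j i' j' H => (h j i j' i' fun s t hs ht => H t s ht hs).symm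

/-- The windows at `(i, j)` and `(i, j + p)` agree, so the difference of `f` at these points has
zero gradient. -/
theorem HasLocalGradient.constant_difference {A : Type*} [AddCommGroup A] {W : ℕ}
    {x : ℤ → ℤ → Bool} {f : ℤ → ℤ → A} (h : HasLocalGradient W x f) {a b c d p : ℤ}
    (hx : ∀ i j, a - W ≤ i → i ≤ b + W → c - W ≤ j → j + p ≤ d + W → x i (j + p) = x i j)
    {i j : ℤ} (hi : a ≤ i) (hi' : i ≤ b) (hj : c ≤ j) (hj' : j + p ≤ d) :
    f i (j + p) - f i j = f a (c + p) - f a c := by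
  have key : ∀ i j, a ≤ i → i ≤ b → c ≤ j → j + p ≤ d →
      f (i + 1) (j + p) - f i (j + p) = f (i + 1) j - f i j ∧
      f i (j + p + 1) - f i (j + p) = f i (j + 1) - f i j := by
    intro i j hi hi' hj hj'
    apply h
    intro s t hs ht
    rw [abs_le] at hs ht
    rw [add_right_comm j p t]
    exact hx _ _ (by omega) (by omega) (by omega) (by omega)
  have h1 := eq_of_forall_succ_eq (g := fun j => f i (j + p) - f i j) (lo := c) (hi := d - p)
    (fun j h1 h2 => by
      have := (key i j hi hi' h1 (by omega)).2
      simp only [add_right_comm j 1 p]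
      rwa [sub_eq_sub_iff_sub_eq_sub]) hj (by omega)
  have h2 := eq_of_forall_succ_eq (g := fun i => f i (c + p) - f i c) (lo := a) (hi := b)
    (fun i h1 h2 => by
      have := (key i c h1 (by omega) le_rfl (by omega)).1
      rwa [sub_eq_sub_iff_sub_eq_sub]) hi hi'
  exact h1.trans h2

theorem dvd_of_smul_eq_smul {p q : ℕ} (hpq : p.Coprime q) {C D : ℤ × ℤ} (h : q • C = p • D) :
    ∃ C' : ℤ × ℤ, C = p • C' := by
  have hc : IsCoprime (p : ℤ) q := Nat.isCoprime_iff_coprime.2 hpq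
  have h1 : (p : ℤ) ∣ C.1 := hc.dvd_of_dvd_mul_left (by
    have := congrArg Prod.fst h
    simp only [nsmul_eq_mul] at this
    exact ⟨_, this⟩)
  have h2 : (p : ℤ) ∣ C.2 := hc.dvd_of_dvd_mul_left (by
    have := congrArg Prod.snd h
    simp only [nsmul_eq_mul] at this
    exact ⟨_, this⟩)
  obtain ⟨a, ha⟩ := h1
  obtain ⟨b, hb⟩ := h2
  exact ⟨(a, b), Prod.ext (by simpa using ha) (by simpa using hb)⟩

/-- Along a period of the lower left quadrant, a function with local gradient changes by a
multiple of the period. -/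
theorem HasLocalGradient.exists_vertical_period {W : ℕ} {p q : ℕ} {S : ℤ} {f : ℤ → ℤ → ℤ × ℤ}
    (hp : 0 < p) (hq : 0 < q) (hpq : p.Coprime q) (hS : p * q + 2 * W < S)
    (h : HasLocalGradient W (boxArray p q S) f) :
    ∃ C : ℤ × ℤ, ∀ i j, -S + W ≤ i → i ≤ -1 - W → -S + W ≤ j → j + p ≤ -1 - W →
      f i (j + p) - f i j = p • C := by
  have hpq1 : (p : ℤ) ≤ p * q := by exact_mod_cast Nat.le_mul_of_pos_right p hq
  have hpq2 : (q : ℤ) ≤ p * q := by exact_mod_cast Nat.le_mul_of_pos_left q hp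
  have hP : ∀ i j, -S + W ≤ i → i ≤ -1 - W → -S + W ≤ j → j + p ≤ -1 - W →
      f i (j + p) - f i j = f (-S + W) (-S + W + p) - f (-S + W) (-S + W) := by
    intro i j h1 h2 h3 h4
    refine h.constant_difference (fun i j h1 h2 h3 h4 => ?_) h1 h2 h3 h4
    exact boxArray_periodic_left (by omega) (by omega) (by omega) (by omega) (by omega)
      (by omega) (by simp [Int.ModEq])
  have hQ : ∀ i j : ℤ, W ≤ i → i ≤ S - 1 - W → -S + W ≤ j → j + q ≤ -1 - W →
      f i (j + q) - f i j = f W (-S + W + q) - f W (-S + W) := by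
    intro i j h1 h2 h3 h4
    refine h.constant_difference (fun i j h1 h2 h3 h4 => ?_) h1 h2 h3 h4
    exact boxArray_periodic_right (by omega) (by omega) (by omega) (by omega) (by omega)
      (by omega) (by simp [Int.ModEq])
  -- This rectangle spans both lower quadrants. A vertical shift keeps each column in its half, so
  -- `p * q` is a period even for windows that straddle the dividing line.
  have hPQ : f W (-S + W + p * q) - f W (-S + W)
      = f (-S + W) (-S + W + p * q) - f (-S + W) (-S + W) := by
    refine h.constant_difference (a := -S + W) (b := S - 1 - W) (c := -S + W) (d := -1 - W)
      (fun i j h1 h2 h3 h4 => ?_) (by omega) (by omega) (by omega) (by omega)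
    rcases lt_or_ge i 0 with hi | hi
    · exact boxArray_periodic_left (by omega) (by omega) (by omega) (by omega) (by omega)
        (by omega) (by simp [Int.ModEq])
    · exact boxArray_periodic_right (by omega) (by omega) (by omega) (by omega) (by omega)
        (by omega) (by simp [Int.ModEq])
  have h1 := sub_eq_nsmul_of_forall_sub_eq (g := fun j => f (-S + W) j) (lo := -S + W)
    (hi := -1 - W) (p := p) (by positivity) (fun j h1 h2 => hP (-S + W) j le_rfl (by omega) h1 h2)
    (j := -S + W) q le_rfl (by rw [mul_comm]; omega)
  have h2 := sub_eq_nsmul_of_forall_sub_eq (g := fun j => f W j) (lo := -S + W)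
    (hi := -1 - W) (p := q) (by positivity) (fun j h1 h2 => hQ W j le_rfl (by omega) h1 h2)
    (j := -S + W) p le_rfl (by omega)
  obtain ⟨C, hC⟩ := dvd_of_smul_eq_smul hpq
    (h1.symm.trans ((mul_comm (p : ℤ) q ▸ hPQ.symm).trans (mul_comm (p : ℤ) q ▸ h2)))
  exact ⟨C, fun i j h1 h2 h3 h4 => (hP i j h1 h2 h3 h4).trans hC⟩

/-- Between congruent points of the lower left quadrant, a function with local gradient changes by
a multiple of the period. -/
theorem HasLocalGradient.exists_eq_smul {W : ℕ} {p q : ℕ} {S : ℤ} {f : ℤ → ℤ → ℤ × ℤ}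
    (hp : 0 < p) (hq : 0 < q) (hpq : p.Coprime q) (hS : p * q + 2 * W < S)
    (h : HasLocalGradient W (boxArray p q S) f) {i j i' j' : ℤ}
    (hi : -S + W ≤ i ∧ i ≤ -1 - W) (hi' : -S + W ≤ i' ∧ i' ≤ -1 - W)
    (hj : -S + W ≤ j ∧ j ≤ -1 - W) (hj' : -S + W ≤ j' ∧ j' ≤ -1 - W)
    (hii : i ≡ i' [ZMOD p]) (hjj : j ≡ j' [ZMOD p]) :
    ∃ C : ℤ × ℤ, f i' j' - f i j = p • C := by
  have step : ∀ g : ℤ → ℤ × ℤ, (∃ C : ℤ × ℤ, ∀ j, -S + W ≤ j → j + p ≤ -1 - W →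
      g (j + p) - g j = p • C) → ∀ j j', j ≤ j' → -S + W ≤ j → j' ≤ -1 - W →
      j ≡ j' [ZMOD p] → ∃ C : ℤ × ℤ, g j' - g j = p • C := by
    rintro g ⟨C, hC⟩ j j' hle h1 h2 hm
    obtain ⟨n, hn⟩ := hm.dvd
    have hn0 : 0 ≤ n := by
      by_contra hneg
      have : (p : ℤ) * n < 0 := mul_neg_of_pos_of_neg (by exact_mod_cast hp) (by omega)
      omega
    lift n to ℕ using hn0
    obtain rfl : j' = j + n * p := by rw [mul_comm] at hn; omega
    refine ⟨n • C, ?_⟩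
    rw [sub_eq_nsmul_of_forall_sub_eq (by positivity) hC n h1 h2, smul_comm]
  have step' : ∀ g : ℤ → ℤ × ℤ, (∃ C : ℤ × ℤ, ∀ j, -S + W ≤ j → j + p ≤ -1 - W →
      g (j + p) - g j = p • C) → ∀ j j', (-S + W ≤ j ∧ j ≤ -1 - W) →
      (-S + W ≤ j' ∧ j' ≤ -1 - W) → j ≡ j' [ZMOD p] → ∃ C : ℤ × ℤ, g j' - g j = p • C := by
    intro g hg j j' h1 h2 hm
    rcases le_total j j' with hle | hle
    · exact step g hg j j' hle h1.1 h2.2 hm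
    · obtain ⟨C, hC⟩ := step g hg j' j hle h2.1 h1.2 hm.symm
      exact ⟨-C, by rw [smul_neg, ← hC, neg_sub]⟩
  obtain ⟨C₁, hC₁⟩ := h.exists_vertical_period hp hq hpq hS
  have hsw : HasLocalGradient W (boxArray p q S) (fun i j => f j i) := by
    convert h.swap using 1
    ext i j
    rw [boxArray_swap]
  obtain ⟨C₂, hC₂⟩ := hsw.exists_vertical_period hp hq hpq hS
  obtain ⟨C, hC⟩ := step' (fun j => f i' j) ⟨C₁, fun j => hC₁ i' j hi'.1 hi'.2⟩ j j' hj hj' hjj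
  obtain ⟨C', hC'⟩ := step' (fun i => f i j) ⟨C₂, fun i => hC₂ j i hj.1 hj.2⟩ i i' hi hi' hii
  exact ⟨C + C', by rw [smul_add, ← hC, ← hC', sub_add_sub_cancel]⟩

/-! ### Continuity and compactness in the free part. -/

theorem freePart.vadd_left_injective {G X : Type*} [AddGroup G] [AddAction G X]
    (x : freePart G X) : Function.Injective fun g : G => g +ᵥ x := by
  intro g g' h
  have h : g +ᵥ x = g' +ᵥ x := h
  by_contra hne
  refine x.2 (-g' + g) (fun h0 => hne ?_) ?_
  · rw [neg_add_eq_zero] at h0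
    exact h0.symm
  · have := congrArg (fun y => -g' +ᵥ y) h
    simp only [← add_vadd, neg_add_cancel, zero_vadd] at this
    exact congrArg Subtype.val this

theorem FZSq.continuous_vadd (g : ZSq) : Continuous fun x : FZSq => g +ᵥ x :=
  Continuous.subtype_mk (continuous_pi fun h : ZSq =>
    (continuous_apply (A := fun _ : ZSq => Bool) (h + g)).comp continuous_subtype_val) _

theorem FZSq.continuous_vadd_self {t : FZSq → ZSq} (ht : Continuous t) :
    Continuous fun y => t y +ᵥ y := by
  refine continuous_iff_continuousAt.2 fun y => ?_
  have hev : (fun z => t y +ᵥ z) =ᶠ[nhds y] fun z => t z +ᵥ z := by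
    filter_upwards [ht.continuousAt.preimage_mem_nhds
      ((isOpen_discrete {t y}).mem_nhds rfl)] with z hz
    have hz : t z = t y := hz
    rw [hz]
  exact (FZSq.continuous_vadd (t y)).continuousAt.congr hev

/-- A complete clopen section has a continuous choice of a point in each orbit. -/
theorem IsCompleteSection.exists_continuous {M : Set FZSq} (hM : IsClopen M)
    (hc : IsCompleteSection ZSq M) :
    ∃ t : FZSq → ZSq, Continuous t ∧ (∀ y, t y +ᵥ y ∈ M) ∧ ∀ y ∈ M, t y = 0 := by
  classical
  obtain ⟨e', he'⟩ := exists_surjective_nat ZSq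
  -- The enumeration starts with `0`, so that a point already in `M` is not moved.
  let e : ℕ → ZSq := fun n => Nat.casesOn n 0 e'
  have he : ∀ y : FZSq, ∃ n, e n +ᵥ y ∈ M := by
    intro y
    obtain ⟨_, hz, g, rfl⟩ := hc y
    obtain ⟨n, rfl⟩ := he' g
    exact ⟨n + 1, hz⟩
  refine ⟨fun y => e (Nat.find (he y)), ?_, fun y => Nat.find_spec (he y), fun y hy => ?_⟩
  · refine Continuous.comp (g := e) (continuous_of_discreteTopology) ?_
    refine IsLocallyConstant.continuous ((IsLocallyConstant.iff_exists_open _).2 fun y => ?_)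
    refine ⟨⋂ n ∈ Set.Iic (Nat.find (he y)), {z | e n +ᵥ z ∈ M ↔ e n +ᵥ y ∈ M},
      (Set.finite_Iic _).isOpen_biInter fun n _ => ?_, ?_, fun z hz => ?_⟩
    · have hcl : IsClopen {z : FZSq | e n +ᵥ z ∈ M} := hM.preimage (FZSq.continuous_vadd (e n))
      by_cases h : e n +ᵥ y ∈ M
      · simpa [h] using hcl.isOpen
      · simp only [h, iff_false]
        exact hcl.compl.isOpen
    · simp
    · simp only [Set.mem_iInter, Set.mem_Iic, Set.mem_ofPred_eq] at hz
      rw [Nat.find_eq_iff]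
      exact ⟨(hz _ le_rfl).2 (Nat.find_spec (he y)),
        fun n hn => fun h => Nat.find_min (he y) hn ((hz n hn.le).1 h)⟩
  · have : Nat.find (he y) = 0 := by
      rw [Nat.find_eq_zero]
      simpa [e] using hy
    simp [this, e]

/-- Locally constant functions on a compact set of points only depend on a finite window. -/
theorem IsLocallyConstant.exists_window {α : Type*} {F : FZSq → α} (hF : IsLocallyConstant F)
    {K : Set FZSq} (hK : IsCompact K) :
    ∃ W : ℕ, ∀ y ∈ K, ∀ y' ∈ K,
      (∀ s t : ℤ, |s| ≤ W → |t| ≤ W → (y : TwoPow ZSq) (s, t) = (y' : TwoPow ZSq) (s, t)) →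
      F y = F y' := by
  have hloc : ∀ y : FZSq, ∃ W : ℕ, ∀ y' : FZSq, (∀ s t : ℤ, |s| ≤ W → |t| ≤ W →
      (y : TwoPow ZSq) (s, t) = (y' : TwoPow ZSq) (s, t)) → F y' = F y := by
    intro y
    obtain ⟨V, hV, hVF⟩ := isOpen_induced_iff.1 (hF.isOpen_fiber (F y))
    have hy : (y : TwoPow ZSq) ∈ V := by
      change y ∈ Subtype.val ⁻¹' V
      rw [hVF]
      rfl
    obtain ⟨I, u, hu, huV⟩ := isOpen_pi_iff.1 hV _ hy
    obtain ⟨W, hW⟩ : ∃ W : ℕ, ∀ i ∈ I, i.1.natAbs + i.2.natAbs ≤ W :=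
      ⟨I.sup fun i => i.1.natAbs + i.2.natAbs,
        fun i hi => Finset.le_sup (f := fun i : ZSq => i.1.natAbs + i.2.natAbs) hi⟩
    refine ⟨W, fun y' hy' => ?_⟩
    have : y' ∈ Subtype.val ⁻¹' V := huV fun i hi => by
      have h1 := hW i hi
      have h2 := hy' i.1 i.2 (by rw [Int.abs_eq_natAbs]; omega) (by rw [Int.abs_eq_natAbs]; omega)
      have h3 := (hu i hi).2
      rwa [h2] at h3
    rwa [hVF] at this
  choose W hW using hloc
  let U : FZSq → Set FZSq := fun y => {y' | ∀ s ∈ Set.Icc (-(W y) : ℤ) (W y),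
    ∀ t ∈ Set.Icc (-(W y) : ℤ) (W y), (y : TwoPow ZSq) (s, t) = (y' : TwoPow ZSq) (s, t)}
  have hU : ∀ y, IsOpen (U y) := by
    intro y
    have : U y = ⋂ s ∈ Set.Icc (-(W y) : ℤ) (W y), ⋂ t ∈ Set.Icc (-(W y) : ℤ) (W y),
        (fun y' : FZSq => (y' : TwoPow ZSq) (s, t)) ⁻¹' {(y : TwoPow ZSq) (s, t)} := by
      ext y'
      simp only [U, Set.mem_ofPred_eq, Set.mem_iInter, Set.mem_preimage, Set.mem_singleton_iff]
      exact forall₄_congr fun _ _ _ _ => eq_comm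
    rw [this]
    refine (Set.finite_Icc _ _).isOpen_biInter fun s _ =>
      (Set.finite_Icc _ _).isOpen_biInter fun t _ => ?_
    exact (isOpen_discrete _).preimage
      ((continuous_apply (A := fun _ : ZSq => Bool) (s, t)).comp continuous_subtype_val)
  obtain ⟨T, hT⟩ := hK.elim_finite_subcover U hU
    (fun y _ => Set.mem_iUnion.2 ⟨y, fun _ _ _ _ => rfl⟩)
  refine ⟨T.sup W, fun y hy y' hy' H => ?_⟩
  obtain ⟨z, hz, hyz⟩ : ∃ z ∈ T, y ∈ U z := by simpa using hT hy
  have hle : W z ≤ T.sup W := Finset.le_sup hz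
  rw [hW z y fun s t hs ht => hyz s (abs_le.1 hs) t (abs_le.1 ht),
    hW z y' fun s t hs ht => (hyz s (abs_le.1 hs) t (abs_le.1 ht)).trans
      (H s t (hs.trans (by exact_mod_cast hle)) (ht.trans (by exact_mod_cast hle)))]

theorem Continuous.exists_natAbs_le {d : FZSq → ZSq} (hd : Continuous d) {K : Set FZSq}
    (hK : IsCompact K) : ∃ L : ℕ, ∀ y ∈ K, (d y).1.natAbs ≤ L ∧ (d y).2.natAbs ≤ L := by
  obtain ⟨L, hL⟩ := hK.bddAbove_image (f := fun y => (d y).1.natAbs + (d y).2.natAbs)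
    ((continuous_of_discreteTopology (f := fun g : ZSq => g.1.natAbs + g.2.natAbs)).comp
      hd).continuousOn
  refine ⟨L, fun y hy => ?_⟩
  have := hL ⟨y, hy, rfl⟩
  simp only at this
  omega

/-- There is a compact invariant set of the free part which contains all of the two-period
arrays. -/
theorem exists_compact_twoPeriodArray :
    ∃ K : Set FZSq, IsCompact K ∧ (∀ (g : ZSq) (y : FZSq), y ∈ K → g +ᵥ y ∈ K) ∧
      ∀ n, ∃ x ∈ K, ∀ i j, (x : TwoPow ZSq) (i, j) = twoPeriodArray n i j := by
  -- Demanding a violation of each `g` in every window of side `N g` is a closed condition, since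
  -- windows are finite. It forces freeness, and `N` is independent of `n`.
  choose N hN using twoPeriodArray_violation
  let C : ∀ g : ZSq, g ≠ 0 → ℤ → ℤ → Set (TwoPow ZSq) := fun g hg s t =>
    ⋃ i ∈ Set.Ico s (s + N g hg), ⋃ j ∈ Set.Ico t (t + N g hg),
      {y | y (i + g.1, j + g.2) ≠ y (i, j)}
  have hmem : ∀ g hg s t y, y ∈ C g hg s t ↔ ∃ i j : ℤ, (s ≤ i ∧ i < s + N g hg) ∧
      (t ≤ j ∧ j < t + N g hg) ∧ y (i + g.1, j + g.2) ≠ y (i, j) := by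
    intro g hg s t y
    simp only [C, Set.mem_iUnion, Set.mem_Ico, exists_prop, Set.mem_ofPred_eq]
    exact ⟨fun ⟨i, hi, j, hj, h⟩ => ⟨i, j, hi, hj, h⟩, fun ⟨i, j, hi, hj, h⟩ => ⟨i, hi, j, hj, h⟩⟩
  let K : Set (TwoPow ZSq) := ⋂ g, ⋂ hg, ⋂ s, ⋂ t, C g hg s t
  have hKC : ∀ y, y ∈ K ↔ ∀ g hg s t, y ∈ C g hg s t := by simp [K]
  have hcl : IsClosed K := by
    refine isClosed_iInter fun g => isClosed_iInter fun hg => isClosed_iInter fun s =>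
      isClosed_iInter fun t => ?_
    refine (Set.finite_Ico _ _).isClosed_biUnion fun i _ =>
      (Set.finite_Ico _ _).isClosed_biUnion fun j _ => ?_
    have h1 : Continuous fun y : TwoPow ZSq => (y (i + g.1, j + g.2), y (i, j)) :=
      (continuous_apply (A := fun _ : ZSq => Bool) (i + g.1, j + g.2)).prodMk
        (continuous_apply (A := fun _ : ZSq => Bool) (i, j))
    exact (isClosed_discrete {b : Bool × Bool | b.1 ≠ b.2}).preimage h1
  have hcomp : IsCompact K := by
    have : CompactSpace (TwoPow ZSq) := inferInstanceAs (CompactSpace (ZSq → Bool))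
    exact hcl.isCompact
  have hfree : K ⊆ freePart ZSq (TwoPow ZSq) := by
    intro y hy g hg h
    obtain ⟨i, j, -, -, hne⟩ := (hmem g hg 0 0 y).1 ((hKC y).1 hy g hg 0 0)
    exact hne (congrFun h (i, j))
  refine ⟨Subtype.val ⁻¹' K, ?_, fun g y hy => ?_, fun n => ?_⟩
  · rwa [Topology.IsInducing.subtypeVal.isCompact_preimage_iff]
    rwa [Subtype.range_coe]
  · refine (hKC _).2 fun k hk s t => (hmem _ _ _ _ _).2 ?_
    obtain ⟨i, j, hi, hj, hne⟩ :=
      (hmem k hk (s + g.1) (t + g.2) y).1 ((hKC y).1 hy k hk (s + g.1) (t + g.2))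
    refine ⟨i - g.1, j - g.2, by omega, by omega, ?_⟩
    have e₁ : ((i - g.1 + k.1, j - g.2 + k.2) + g : ZSq) = (i + k.1, j + k.2) :=
      Prod.ext (by simp only [Prod.fst_add]; ring) (by simp only [Prod.snd_add]; ring)
    have e₂ : ((i - g.1, j - g.2) + g : ZSq) = (i, j) := Prod.ext (by simp) (by simp)
    rwa [freePart.coe_vadd, TwoPow.vadd_apply, TwoPow.vadd_apply, e₁, e₂]
  · let x : TwoPow ZSq := fun u => twoPeriodArray n u.1 u.2
    have hx : x ∈ K := (hKC x).2 fun g hg s t => (hmem _ _ _ _ _).2 (hN g hg n s t)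
    exact ⟨⟨x, hfree hx⟩, hx, fun i j => rfl⟩

/-- A continuous free subaction has a continuous cocycle `σ`, which compares the points that a
continuous choice of points in the section selects for `x` and for `g · x`. -/
theorem IsContinuousSubaction.exists_cocycle {M : Set FZSq} [star : AddAction ZSq M]
    (hsub : IsSubaction (G := ZSq) M star) (hfree : IsFreeAction star) {φ : ZSq × M → ZSq}
    (hφ : Continuous φ) (hφv : ∀ (h : ZSq) (y : M), ((h +ᵥ y : M) : FZSq) = φ (h, y) +ᵥ (y : FZSq))
    {t : FZSq → ZSq} (ht : Continuous t) (htM : ∀ y, t y +ᵥ y ∈ M) :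
    ∃ σ : ZSq → FZSq → ZSq, (∀ g, Continuous (σ g)) ∧
      ∀ (g : ZSq) (y : FZSq) (h : ZSq), σ g y = h ↔
        h +ᵥ (⟨t y +ᵥ y, htM y⟩ : M) = ⟨t (g +ᵥ y) +ᵥ (g +ᵥ y), htM (g +ᵥ y)⟩ := by
  let π : FZSq → M := fun y => ⟨t y +ᵥ y, htM y⟩
  have hex : ∀ (g : ZSq) (y : FZSq), ∃ h : ZSq, h +ᵥ π y = π (g +ᵥ y) := by
    intro g y
    refine (hsub (π y) (π (g +ᵥ y))).2 ⟨t (g +ᵥ y) + g - t y, ?_⟩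
    simp only [π, ← add_vadd, sub_add_cancel]
  choose σ hσ using hex
  have huniq : ∀ (y : M) (h h' : ZSq), h +ᵥ y = h' +ᵥ y → h = h' := by
    intro y h h' e
    by_contra hne
    refine hfree (-h' + h) (fun h0 => hne ?_) y ?_
    · rw [neg_add_eq_zero] at h0
      exact h0.symm
    · change (-h' + h) +ᵥ y = y
      rw [add_vadd, e, neg_vadd_vadd]
  have hiff : ∀ (g : ZSq) (y : FZSq) (h : ZSq), σ g y = h ↔ h +ᵥ π y = π (g +ᵥ y) := fun g y h =>
    ⟨fun e => e ▸ hσ g y, fun e => huniq _ _ _ ((hσ g y).trans e.symm)⟩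
  refine ⟨σ, fun g => ?_, hiff⟩
  -- For fixed `h` this equates two continuous maps into a discrete group, so `σ g` is locally
  -- constant.
  have htrans : ∀ (g : ZSq) (y : FZSq) (h : ZSq), σ g y = h ↔ φ (h, π y) + t y = t (g +ᵥ y) + g := by
    intro g y h
    rw [hiff, Subtype.ext_iff, hφv]
    simp only [π, ← add_vadd]
    exact (freePart.vadd_left_injective y).eq_iff
  have hπ : Continuous π := (FZSq.continuous_vadd_self ht).subtype_mk _
  refine IsLocallyConstant.continuous ((IsLocallyConstant.iff_exists_open _).2 fun y => ?_)
  refine ⟨(fun z => (φ (σ g y, π z) + t z, t (g +ᵥ z) + g)) ⁻¹' {b | b.1 = b.2},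
    (isOpen_discrete _).preimage ?_, (htrans g y _).1 rfl, fun z hz => (htrans g z _).2 hz⟩
  refine Continuous.prodMk ?_ ?_
  · exact (hφ.comp (continuous_const.prodMk hπ)).add ht
  · exact (ht.comp (FZSq.continuous_vadd g)).add continuous_const

/-! ### The contradiction for continuous free subactions. -/

/-- The point `(-Z, -Z)` lies so deep in the quadrant that an initial displacement of at most `n`,
followed by fewer than `2 * (n + 2)` steps of size at most `n`, stays at window distance from its
sides. -/
theorem two_period_inequalities (n W : ℕ) (hn : W ≤ n) :
    ((n + 2 : ℕ) : ℤ) * (n + 3 : ℕ) + 2 * W < (n + 2) * ((n + 2) * (n + 3) ^ 2) ∧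
    ∃ Z : ℤ, -((n + 2) * ((n + 2) * (n + 3) ^ 2)) + W + 2 * (n + 2) * (n + 2) + n ≤ -Z ∧
      -Z + 2 * (n + 2) * (n + 2) + n ≤ -1 - (W : ℤ) := by
  have hn' : (W : ℤ) ≤ n := by exact_mod_cast hn
  have hn0 : (0 : ℤ) ≤ n := by positivity
  have e : ((n : ℤ) + 2) * ((n + 2) * (n + 3) ^ 2)
      = n ^ 4 + 10 * n ^ 3 + 37 * n ^ 2 + 60 * n + 36 := by ring
  have h4 : (0 : ℤ) ≤ n ^ 4 := by positivity
  have h3 : (0 : ℤ) ≤ n ^ 3 := by positivity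
  have h2 : (0 : ℤ) ≤ n ^ 2 := by positivity
  rw [e]
  refine ⟨?_, 4 * (n + 2) ^ 2, ?_, ?_⟩
  · push_cast
    nlinarith
  · nlinarith
  · nlinarith

/-- There is no continuous free subaction on a clopen, complete, co-complete section. -/
theorem not_exists_continuous_free_subaction {M : Set FZSq} [star : AddAction ZSq M]
    (hM : IsClopen M) (hc : IsCompleteSection ZSq M) (hcc : IsCoCompleteSection ZSq M)
    (hsub : IsContinuousSubaction (G := ZSq) M star) (hfree : IsFreeAction star) : False := by
  obtain ⟨hsub, φ, hφ, hφv⟩ := hsub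
  replace hφv : ∀ (h : ZSq) (y : M), ((h +ᵥ y : M) : FZSq) = φ (h, y) +ᵥ (y : FZSq) := hφv
  obtain ⟨t, ht, htM, ht0⟩ := hc.exists_continuous hM
  obtain ⟨t', ht', htM', -⟩ := IsCompleteSection.exists_continuous hM.compl hcc
  obtain ⟨σ, hσ, hσiff⟩ := IsContinuousSubaction.exists_cocycle hsub hfree hφ hφv ht htM
  obtain ⟨K, hK, hKinv, hKx⟩ := exists_compact_twoPeriodArray
  let π : FZSq → M := fun y => ⟨t y +ᵥ y, htM y⟩
  have hσπ : ∀ g y, σ g y +ᵥ π y = π (g +ᵥ y) := fun g y => (hσiff g y _).1 rfl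
  have hπM : ∀ y : M, π y = y := fun y => Subtype.ext (by simp [π, ht0 y y.2])
  have hcoc : ∀ g' g y, σ (g' + g) y = σ g' (g +ᵥ y) + σ g y := by
    intro g' g y
    refine (hσiff _ _ _).2 ?_
    change (σ g' (g +ᵥ y) + σ g y) +ᵥ π y = π ((g' + g) +ᵥ y)
    rw [add_vadd, hσπ, hσπ, add_vadd]
  have hφadd : ∀ g h (y : M), φ (g + h, y) = φ (g, h +ᵥ y) + φ (h, y) := by
    intro g h y
    refine freePart.vadd_left_injective (y : FZSq) ?_
    change φ (g + h, y) +ᵥ (y : FZSq) = (φ (g, h +ᵥ y) + φ (h, y)) +ᵥ (y : FZSq)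
    rw [add_vadd, ← hφv, ← hφv, ← hφv, add_vadd]
  -- finite windows and bounds
  have hMloc : IsLocallyConstant fun y => (y ∈ M : Prop) := by
    refine (IsLocallyConstant.iff_exists_open _).2 fun y => ?_
    by_cases hy : y ∈ M
    · exact ⟨M, hM.isOpen, hy, fun z hz => by simp [hz, hy]⟩
    · exact ⟨Mᶜ, hM.compl.isOpen, hy, fun z hz => by
        simp only [hy]
        exact eq_false hz⟩
  obtain ⟨W, hW⟩ := ((((IsLocallyConstant.iff_continuous _).2 (hσ (1, 0))).prodMk
    ((IsLocallyConstant.iff_continuous _).2 (hσ (0, 1)))).prodMk hMloc).exists_window hK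
  have hπc : Continuous π := (FZSq.continuous_vadd_self ht).subtype_mk _
  obtain ⟨L₁, hL₁⟩ := (hφ.comp ((continuous_const (y := ((1, 0) : ZSq))).prodMk
    hπc)).exists_natAbs_le hK
  obtain ⟨L₂, hL₂⟩ := (hφ.comp ((continuous_const (y := ((0, 1) : ZSq))).prodMk
    hπc)).exists_natAbs_le hK
  obtain ⟨L₃, hL₃⟩ := ht.exists_natAbs_le hK
  obtain ⟨L₄, hL₄⟩ := ht'.exists_natAbs_le hK
  simp only [Function.comp] at hL₁ hL₂
  -- All these bounds hold on `K` and precede the choice of `n`, hence of the test array.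
  obtain ⟨n, hn⟩ : ∃ n, n = W + L₁ + L₂ + L₃ + L₄ := ⟨_, rfl⟩
  obtain ⟨x, hxK, hx⟩ := hKx n
  obtain ⟨hS, Z, hZ, hZ'⟩ := two_period_inequalities n W (by omega)
  obtain ⟨S, hSdef⟩ : ∃ S : ℤ, S = (n + 2) * ((n + 2) * (n + 3) ^ 2) := ⟨_, rfl⟩
  rw [← hSdef] at hS hZ
  replace hx : ∀ i j, (x : TwoPow ZSq) (i, j)
      = boxArray (n + 2 : ℕ) (n + 3 : ℕ) S i j := by
    intro i j
    rw [hx, twoPeriodArray, hSdef]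
    push_cast
    rfl
  have hwin : ∀ u v : ZSq, (∀ s t : ℤ, |s| ≤ W → |t| ≤ W →
      boxArray (n + 2 : ℕ) (n + 3 : ℕ) S (u.1 + s) (u.2 + t)
        = boxArray (n + 2 : ℕ) (n + 3 : ℕ) S (v.1 + s) (v.2 + t)) →
      (σ (1, 0) (u +ᵥ x) = σ (1, 0) (v +ᵥ x) ∧ σ (0, 1) (u +ᵥ x) = σ (0, 1) (v +ᵥ x)) ∧
        (u +ᵥ x ∈ M ↔ v +ᵥ x ∈ M) := by
    intro u v H
    have := hW (u +ᵥ x) (hKinv _ _ hxK) (v +ᵥ x) (hKinv _ _ hxK) fun s t hs ht => by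
      have := H s t hs ht
      rw [← hx, ← hx] at this
      rw [freePart.coe_vadd, freePart.coe_vadd, TwoPow.vadd_apply, TwoPow.vadd_apply]
      have e : ∀ u : ZSq, ((s, t) + u : ZSq) = (u.1 + s, u.2 + t) :=
        fun u => Prod.ext (add_comm _ _) (add_comm _ _)
      rwa [e, e]
    simp only [Prod.mk.injEq] at this
    exact ⟨this.1, iff_of_eq this.2⟩
  have hgrad : HasLocalGradient W (boxArray (n + 2 : ℕ) (n + 3 : ℕ) S)
      (fun i j => σ (i, j) x) := by
    intro i j i' j' H
    have h1 : ∀ i j : ℤ, σ (i + 1, j) x - σ (i, j) x = σ (1, 0) (((i, j) : ZSq) +ᵥ x) := by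
      intro i j
      have : ((i + 1, j) : ZSq) = (1, 0) + (i, j) := by simp [add_comm]
      rw [this, hcoc, add_sub_cancel_right]
    have h2 : ∀ i j : ℤ, σ (i, j + 1) x - σ (i, j) x = σ (0, 1) (((i, j) : ZSq) +ᵥ x) := by
      intro i j
      have : ((i, j + 1) : ZSq) = (0, 1) + (i, j) := by simp [add_comm]
      rw [this, hcoc, add_sub_cancel_right]
    simp only [h1, h2]
    exact (hwin (i, j) (i', j') H).1
  have hcop : (n + 2).Coprime (n + 2 + 1) := by simp
  -- the points of the section reached from a base point
  let z₀ : ZSq := (-Z, -Z)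
  have hz₀K : z₀ +ᵥ x ∈ K := hKinv _ _ hxK
  let y₀ : M := π (z₀ +ᵥ x)
  let w₀ : ZSq := t (z₀ +ᵥ x) + z₀
  have hy₀ : (y₀ : FZSq) = w₀ +ᵥ x := (add_vadd _ _ _).symm
  let v : ℕ → ℕ → ZSq := fun a b => φ ((a, b), y₀) + w₀
  have hv : ∀ a b : ℕ, (((((a : ℤ), (b : ℤ)) : ZSq) +ᵥ y₀ : M) : FZSq) = v a b +ᵥ x := by
    intro a b
    rw [hφv, hy₀, ← add_vadd]
  have hvK : ∀ a b : ℕ, (((((a : ℤ), (b : ℤ)) : ZSq) +ᵥ y₀ : M) : FZSq) ∈ K := fun a b => by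
    rw [hv]
    exact hKinv _ _ hxK
  have hv₀ : v 0 0 = w₀ := by
    have h0 := hv 0 0
    rw [show (((0 : ℕ) : ℤ), ((0 : ℕ) : ℤ)) = (0 : ZSq) from rfl, zero_vadd, hy₀] at h0
    exact (freePart.vadd_left_injective x h0).symm
  have hv₁ : ∀ a b, v (a + 1) b - v a b = φ ((1, 0), (((a : ℤ), (b : ℤ)) : ZSq) +ᵥ y₀) := by
    intro a b
    have : ((((a + 1 : ℕ) : ℤ), (b : ℤ)) : ZSq) = (1, 0) + ((a : ℤ), (b : ℤ)) := by
      simp [add_comm]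
    simp only [v]
    rw [this, hφadd]
    abel
  have hv₂ : ∀ a b, v a (b + 1) - v a b = φ ((0, 1), (((a : ℤ), (b : ℤ)) : ZSq) +ᵥ y₀) := by
    intro a b
    have : (((a : ℤ), ((b + 1 : ℕ) : ℤ)) : ZSq) = (0, 1) + ((a : ℤ), (b : ℤ)) := by
      simp [add_comm]
    simp only [v]
    rw [this, hφadd]
    abel
  have hvb₁ : ∀ a b, (v (a + 1) b - v a b).1.natAbs ≤ n ∧ (v (a + 1) b - v a b).2.natAbs ≤ n := by
    intro a b
    have := hL₁ _ (hvK a b)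
    rw [hπM] at this
    rw [hv₁]
    omega
  have hvb₂ : ∀ a b, (v a (b + 1) - v a b).1.natAbs ≤ n ∧ (v a (b + 1) - v a b).2.natAbs ≤ n := by
    intro a b
    have := hL₂ _ (hvK a b)
    rw [hπM] at this
    rw [hv₂]
    omega
  have hvb : ∀ a b, (v a b - w₀).1.natAbs ≤ (a + b) * n ∧ (v a b - w₀).2.natAbs ≤ (a + b) * n := by
    intro a b
    induction a with
    | zero =>
      induction b with
      | zero => simp [hv₀]
      | succ b ih =>
        have := hvb₂ 0 b
        simp only [Prod.fst_sub, Prod.snd_sub] at this ih ⊢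
        have e : (0 + (b + 1)) * n = (0 + b) * n + n := by ring
        omega
    | succ a ih =>
      have := hvb₁ a b
      simp only [Prod.fst_sub, Prod.snd_sub] at this ih ⊢
      have e : (a + 1 + b) * n = (a + b) * n + n := by ring
      omega
  have hvbox : ∀ a b, a < n + 2 → b < n + 2 →
      (-S + W ≤ (v a b).1 ∧ (v a b).1 ≤ -1 - W) ∧ (-S + W ≤ (v a b).2 ∧ (v a b).2 ≤ -1 - W) := by
    intro a b ha hb
    have h1 := hvb a b
    have h2 := hL₃ _ hz₀K
    have h3 : (a + b) * n ≤ 2 * (n + 2) * (n + 2) := by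
      apply Nat.mul_le_mul <;> omega
    have hw₁ : w₀.1 = (t (z₀ +ᵥ x)).1 + -Z := rfl
    have hw₂ : w₀.2 = (t (z₀ +ᵥ x)).2 + -Z := rfl
    simp only [Prod.fst_sub, Prod.snd_sub] at h1
    obtain ⟨P, hP⟩ : ∃ P, P = (a + b) * n := ⟨_, rfl⟩
    have h4 : (P : ℤ) ≤ 2 * (n + 2) * (n + 2) := by rw [hP]; exact_mod_cast h3
    rw [← hP] at h1
    omega
  -- All these points lie in `M`, where `π` is the identity, so `σ` reads off the group element `(a,
  -- b)` up to a constant.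
  have hvσ : ∀ a b : ℕ, σ (v a b) x = ((a : ℤ), (b : ℤ)) + σ w₀ x := by
    intro a b
    refine (hσiff _ _ _).2 ?_
    change (((a : ℤ), (b : ℤ)) + σ w₀ x) +ᵥ π x = π (v a b +ᵥ x)
    rw [add_vadd, hσπ, ← hv, hπM, ← hy₀, hπM]
  let r : Fin (n + 2) × Fin (n + 2) → ZMod (n + 2) × ZMod (n + 2) := fun h =>
    (((v h.1 h.2).1 : ZMod (n + 2)), ((v h.1 h.2).2 : ZMod (n + 2)))
  have hr : Function.Injective r := by
    -- Congruent positions would make `(a', b') - (a, b)` divisible by `n + 2`, while all four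
    -- entries are below `n + 2`.
    rintro ⟨a, b⟩ ⟨a', b'⟩ h
    simp only [r, Prod.mk.injEq, ZMod.intCast_eq_intCast_iff] at h
    have hb := hvbox a b a.2 b.2
    have hb' := hvbox a' b' a'.2 b'.2
    obtain ⟨C, hC⟩ := hgrad.exists_eq_smul (by omega) (by omega) hcop hS hb.1 hb'.1 hb.2 hb'.2
      h.1 h.2
    have hC : σ (v a' b') x - σ (v a b) x = (n + 2) • C := hC
    rw [hvσ, hvσ, add_sub_add_right_eq_sub] at hC
    have e1 : (a : ℕ) ≡ a' [MOD n + 2] := by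
      rw [← Int.natCast_modEq_iff, Int.modEq_iff_dvd]
      exact ⟨C.1, by simpa using congrArg Prod.fst hC⟩
    have e2 : (b : ℕ) ≡ b' [MOD n + 2] := by
      rw [← Int.natCast_modEq_iff, Int.modEq_iff_dvd]
      exact ⟨C.2, by simpa using congrArg Prod.snd hC⟩
    exact Prod.ext (Fin.ext (e1.eq_of_lt_of_lt a.2 a'.2)) (Fin.ext (e2.eq_of_lt_of_lt b.2 b'.2))
  have hrs : Function.Surjective r := (hr.bijective_of_nat_card_le (by simp)).2
  -- a point outside of the section
  let z₁ : ZSq := t' (z₀ +ᵥ x) + z₀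
  have hz₁ : z₁ +ᵥ x ∉ M := by
    rw [add_vadd]
    exact htM' _
  have hz₁box : (-S + W ≤ z₁.1 ∧ z₁.1 ≤ -1 - W) ∧ (-S + W ≤ z₁.2 ∧ z₁.2 ≤ -1 - W) := by
    have h2 := hL₄ _ hz₀K
    have h3 : (0 : ℤ) ≤ 2 * (n + 2) * (n + 2) := by positivity
    have hw₁ : z₁.1 = (t' (z₀ +ᵥ x)).1 + -Z := rfl
    have hw₂ : z₁.2 = (t' (z₀ +ᵥ x)).2 + -Z := rfl
    omega
  obtain ⟨⟨a, b⟩, hab⟩ := hrs ((z₁.1 : ZMod (n + 2)), (z₁.2 : ZMod (n + 2)))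
  simp only [r, Prod.mk.injEq, ZMod.intCast_eq_intCast_iff] at hab
  have hb := hvbox a b a.2 b.2
  -- A point of `M` in the residue class of `z₁` has the same window as `z₁`, by a vertical and then
  -- a horizontal shift by periods.
  refine hz₁ (((hwin (v a b) z₁ fun s t hs ht => ?_).2).1 ?_)
  · rw [abs_le] at hs ht
    rw [boxArray_periodic_left (by omega) (by omega) (by omega) (by omega) (by omega) (by omega)
      (hab.2.add_right t), boxArray_swap, boxArray_swap _ _ _ (z₁.1 + s)]
    exact boxArray_periodic_left (by omega) (by omega) (by omega) (by omega) (by omega) (by omega)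
      (hab.1.add_right s)
  · rw [← hv]
    exact Subtype.coe_prop _

/-! ### Lined-up tilings of the integer lattice. -/

/-- The rectangle `[a, b] × [c, d]` in the integer lattice. -/
@[ext]
structure Rect where
  /-- left side -/
  a : ℤ
  /-- right side -/
  b : ℤ
  /-- bottom side -/
  c : ℤ
  /-- top side -/
  d : ℤ

namespace Rect

/-- The point `(i, j)` belongs to the rectangle. -/
def Mem (R : Rect) (i j : ℤ) : Prop := (R.a ≤ i ∧ i ≤ R.b) ∧ (R.c ≤ j ∧ j ≤ R.d)

/-- The rectangle reflected at the diagonal. -/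
def swap (R : Rect) : Rect := ⟨R.c, R.d, R.a, R.b⟩

/-- The rectangle reflected at the horizontal axis. -/
def flip (R : Rect) : Rect := ⟨R.a, R.b, -R.d, -R.c⟩

/-- The rectangle translated by `g`. -/
def translate (g : ZSq) (R : Rect) : Rect := ⟨R.a + g.1, R.b + g.1, R.c + g.2, R.d + g.2⟩

theorem flip_flip (R : Rect) : R.flip.flip = R := by
  ext <;> simp [flip]

/-- `S` is adjacent to `R` on the right, with overlap at least `k`. -/
def RightOf (k : ℤ) (R S : Rect) : Prop :=
  S.a = R.b + 1 ∧ k ≤ R.d - S.c + 1 ∧ k ≤ S.d - R.c + 1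

/-- `S` is adjacent to `R` on the top, with overlap at least `k`. -/
def UpOf (k : ℤ) (R S : Rect) : Prop :=
  S.c = R.d + 1 ∧ k ≤ R.b - S.a + 1 ∧ k ≤ S.b - R.a + 1

theorem rightOf_translate {k : ℤ} {g : ZSq} {R S : Rect} :
    RightOf k (R.translate g) (S.translate g) ↔ RightOf k R S := by
  simp only [RightOf, translate]
  omega

theorem upOf_translate {k : ℤ} {g : ZSq} {R S : Rect} :
    UpOf k (R.translate g) (S.translate g) ↔ UpOf k R S := by
  simp only [UpOf, translate]
  omega

end Rect

open Rect in
/-- A tiling of the integer lattice by rectangles with side lengths between `k` and `2 k - 1`, each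
of which has neighbours with overlap at least `k` on all four sides. -/
structure IsLinedUpTiling (k : ℤ) (T : Set Rect) : Prop where
  pos : 1 ≤ k
  eq_of_mem : ∀ R ∈ T, ∀ S ∈ T, ∀ i j, R.Mem i j → S.Mem i j → R = S
  exists_mem : ∀ i j, ∃ R ∈ T, R.Mem i j
  width : ∀ R ∈ T, k ≤ R.b - R.a + 1 ∧ R.b - R.a + 1 ≤ 2 * k - 1
  height : ∀ R ∈ T, k ≤ R.d - R.c + 1 ∧ R.d - R.c + 1 ≤ 2 * k - 1
  right : ∀ R ∈ T, ∃ S ∈ T, RightOf k R S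
  left : ∀ R ∈ T, ∃ S ∈ T, RightOf k S R
  up : ∀ R ∈ T, ∃ S ∈ T, UpOf k R S
  down : ∀ R ∈ T, ∃ S ∈ T, UpOf k S R

namespace IsLinedUpTiling

open Rect

variable {k : ℤ} {T : Set Rect}

theorem swap (h : IsLinedUpTiling k T) : IsLinedUpTiling k (Rect.swap ⁻¹' T) where
  pos := h.pos
  eq_of_mem R hR S hS i j hi hj :=
    congrArg Rect.swap (h.eq_of_mem R.swap hR S.swap hS j i hi.symm hj.symm)
  exists_mem i j := by
    obtain ⟨R, hR, hm⟩ := h.exists_mem j i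
    exact ⟨R.swap, hR, hm.symm⟩
  width R hR := h.height R.swap hR
  height R hR := h.width R.swap hR
  right R hR := by
    obtain ⟨S, hS, hRS⟩ := h.up R.swap hR
    exact ⟨S.swap, hS, hRS⟩
  left R hR := by
    obtain ⟨S, hS, hRS⟩ := h.down R.swap hR
    exact ⟨S.swap, hS, hRS⟩
  up R hR := by
    obtain ⟨S, hS, hRS⟩ := h.right R.swap hR
    exact ⟨S.swap, hS, hRS⟩
  down R hR := by
    obtain ⟨S, hS, hRS⟩ := h.left R.swap hR
    exact ⟨S.swap, hS, hRS⟩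

theorem flip (h : IsLinedUpTiling k T) : IsLinedUpTiling k (Rect.flip ⁻¹' T) where
  pos := h.pos
  eq_of_mem R hR S hS i j hi hj := by
    have := congrArg Rect.flip (h.eq_of_mem R.flip hR S.flip hS i (-j)
      (by simp only [Mem, Rect.flip] at hi ⊢; omega) (by simp only [Mem, Rect.flip] at hj ⊢; omega))
    rwa [Rect.flip_flip, Rect.flip_flip] at this
  exists_mem i j := by
    obtain ⟨R, hR, hm⟩ := h.exists_mem i (-j)
    exact ⟨R.flip, by rwa [Set.mem_preimage, Rect.flip_flip],
      by simp only [Mem, Rect.flip] at hm ⊢; omega⟩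
  width R hR := h.width R.flip hR
  height R hR := by
    have := h.height R.flip hR
    simp only [Rect.flip] at this
    omega
  right R hR := by
    obtain ⟨S, hS, hRS⟩ := h.right R.flip hR
    exact ⟨S.flip, by rwa [Set.mem_preimage, Rect.flip_flip],
      by simp only [RightOf, Rect.flip] at hRS ⊢; omega⟩
  left R hR := by
    obtain ⟨S, hS, hRS⟩ := h.left R.flip hR
    exact ⟨S.flip, by rwa [Set.mem_preimage, Rect.flip_flip],
      by simp only [RightOf, Rect.flip] at hRS ⊢; omega⟩
  up R hR := by
    obtain ⟨S, hS, hRS⟩ := h.down R.flip hR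
    exact ⟨S.flip, by rwa [Set.mem_preimage, Rect.flip_flip],
      by simp only [UpOf, Rect.flip] at hRS ⊢; omega⟩
  down R hR := by
    obtain ⟨S, hS, hRS⟩ := h.up R.flip hR
    exact ⟨S.flip, by rwa [Set.mem_preimage, Rect.flip_flip],
      by simp only [UpOf, Rect.flip] at hRS ⊢; omega⟩

/-- The height of `R` is at most `2 * k - 1`, so every overlap of length `k` with its right side
contains the middle row `R.c + k - 1`. -/
theorem rightOf_unique (h : IsLinedUpTiling k T) {R S S' : Rect} (hR : R ∈ T) (hS : S ∈ T)
    (hS' : S' ∈ T) (h1 : RightOf k R S) (h2 : RightOf k R S') : S = S' := by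
  have := h.pos
  have := h.height R hR
  have := h.width S hS
  have := h.width S' hS'
  simp only [RightOf] at h1 h2
  refine h.eq_of_mem S hS S' hS' (R.b + 1) (R.c + k - 1) ?_ ?_ <;> simp only [Mem] <;> omega

theorem leftOf_unique (h : IsLinedUpTiling k T) {R S S' : Rect} (hR : R ∈ T) (hS : S ∈ T)
    (hS' : S' ∈ T) (h1 : RightOf k S R) (h2 : RightOf k S' R) : S = S' := by
  have := h.pos
  have := h.height R hR
  have := h.width S hS
  have := h.width S' hS'
  simp only [RightOf] at h1 h2
  refine h.eq_of_mem S hS S' hS' S.b (R.c + k - 1) ?_ ?_ <;> simp only [Mem] <;> omega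

theorem upOf_unique (h : IsLinedUpTiling k T) {R S S' : Rect} (hR : R ∈ T) (hS : S ∈ T)
    (hS' : S' ∈ T) (h1 : UpOf k R S) (h2 : UpOf k R S') : S = S' :=
  congrArg Rect.swap (h.swap.rightOf_unique (R := R.swap) (S := S.swap) (S' := S'.swap)
    hR hS hS' h1 h2)

theorem downOf_unique (h : IsLinedUpTiling k T) {R S S' : Rect} (hR : R ∈ T) (hS : S ∈ T)
    (hS' : S' ∈ T) (h1 : UpOf k S R) (h2 : UpOf k S' R) : S = S' :=
  congrArg Rect.swap (h.swap.leftOf_unique (R := R.swap) (S := S.swap) (S' := S'.swap)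
    hR hS hS' h1 h2)

/-- If the upper neighbour `R₃` of `R₁` ends before `R₁`, then the right neighbour of `R₃` also
sits on top of `R₁`. -/
theorem bottom_eq (h : IsLinedUpTiling k T) {R₁ R₃ R₅ : Rect} (h₁ : R₁ ∈ T) (h₃ : R₃ ∈ T)
    (h₅ : R₅ ∈ T) (h13 : UpOf k R₁ R₃) (h35 : RightOf k R₃ R₅) (hlt : R₃.b < R₁.b) :
    R₅.c = R₁.d + 1 := by
  obtain ⟨R₆, h₆, hm⟩ := h.exists_mem R₁.b (R₁.d + 1)
  have := h.pos
  have := h.width R₁ h₁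
  have := h.height R₁ h₁
  have := h.height R₃ h₃
  have := h.width R₅ h₅
  have := h.height R₅ h₅
  have := h.height R₆ h₆
  simp only [UpOf, RightOf, Mem] at h13 h35 hm
  have h6c : R₆.c = R₁.d + 1 := by
    by_contra hne
    have := h.eq_of_mem R₁ h₁ R₆ h₆ R₁.b R₁.d (by simp only [Mem]; omega)
      (by simp only [Mem]; omega)
    subst this
    omega
  -- `R₃` covers at least `k` of at most `2 * k - 1` columns of `R₁`, so `R₅`, of width at least
  -- `k`, reaches column `R₁.b`.
  have : R₅ = R₆ := h.eq_of_mem R₅ h₅ R₆ h₆ R₁.b (max R₅.c (R₁.d + 1))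
    (by simp only [Mem]; omega) (by simp only [Mem]; omega)
  rw [this, h6c]

theorem left_eq (h : IsLinedUpTiling k T) {R₁ R₂ R₄ : Rect} (h₁ : R₁ ∈ T) (h₂ : R₂ ∈ T)
    (h₄ : R₄ ∈ T) (h12 : RightOf k R₁ R₂) (h24 : UpOf k R₂ R₄) (hlt : R₂.d < R₁.d) :
    R₄.a = R₁.b + 1 :=
  h.swap.bottom_eq (R₁ := R₁.swap) (R₃ := R₂.swap) (R₅ := R₄.swap) h₁ h₂ h₄ h12 h24 hlt

/-- Here `R₅` rests on the top line of `R₁` and extends past its right end. This forces `R₂` to end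
at that line, so `R₂` is the lower neighbour of `R₅`. -/
theorem comm_of_lt_of_le (h : IsLinedUpTiling k T) {R₁ R₂ R₃ R₄ R₅ : Rect} (h₁ : R₁ ∈ T)
    (h₂ : R₂ ∈ T) (h₃ : R₃ ∈ T) (h₄ : R₄ ∈ T) (h₅ : R₅ ∈ T) (h12 : RightOf k R₁ R₂)
    (h13 : UpOf k R₁ R₃) (h24 : UpOf k R₂ R₄) (h35 : RightOf k R₃ R₅) (hlt : R₃.b < R₁.b)
    (hle : R₁.d ≤ R₂.d) : R₄ = R₅ := by
  have h5c := h.bottom_eq h₁ h₃ h₅ h13 h35 hlt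
  have := h.pos
  have := h.width R₁ h₁
  have := h.width R₂ h₂
  have := h.height R₂ h₂
  have := h.width R₅ h₅
  have := h.height R₅ h₅
  obtain ⟨R₇, h₇, h75⟩ := h.down R₅ h₅
  have := h.height R₇ h₇
  refine h.upOf_unique h₂ h₄ h₅ h24 ?_
  convert h75 using 1
  simp only [UpOf, RightOf] at h12 h13 h24 h35 h75
  -- If `R₂` were higher it would meet `R₅` at `(R₁.b + 1, R₁.d + 1)`, although their left sides
  -- differ.
  have h2d : R₂.d = R₁.d := by
    by_contra hne
    have := h.eq_of_mem R₂ h₂ R₅ h₅ (R₁.b + 1) (R₁.d + 1) (by simp only [Mem]; omega)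
      (by simp only [Mem]; omega)
    subst this
    omega
  exact h.eq_of_mem R₂ h₂ R₇ h₇ (R₃.b + k) R₁.d (by simp only [Mem]; omega)
    (by simp only [Mem]; omega)

/-- The right neighbour of the upper neighbour is the upper neighbour of the right neighbour. -/
theorem comm (h : IsLinedUpTiling k T) {R₁ R₂ R₃ R₄ R₅ : Rect} (h₁ : R₁ ∈ T)
    (h₂ : R₂ ∈ T) (h₃ : R₃ ∈ T) (h₄ : R₄ ∈ T) (h₅ : R₅ ∈ T) (h12 : RightOf k R₁ R₂)
    (h13 : UpOf k R₁ R₃) (h24 : UpOf k R₂ R₄) (h35 : RightOf k R₃ R₅) : R₄ = R₅ := by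
  rcases lt_or_ge R₃.b R₁.b with hb | hb
  · rcases lt_or_ge R₂.d R₁.d with hd | hd
    · have := h.bottom_eq h₁ h₃ h₅ h13 h35 hb
      have := h.left_eq h₁ h₂ h₄ h12 h24 hd
      have := h.pos
      have := h.width R₁ h₁
      have := h.height R₁ h₁
      have := h.width R₄ h₄
      have := h.height R₄ h₄
      have := h.width R₅ h₅
      have := h.height R₅ h₅
      simp only [UpOf, RightOf] at h12 h13 h24 h35
      -- Both tiles contain the point diagonally beyond the corner of `R₁`.
      exact h.eq_of_mem R₄ h₄ R₅ h₅ (R₁.b + 1) (R₁.d + 1) (by simp only [Mem]; omega)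
        (by simp only [Mem]; omega)
    · exact h.comm_of_lt_of_le h₁ h₂ h₃ h₄ h₅ h12 h13 h24 h35 hb hd
  · rcases lt_or_ge R₂.d R₁.d with hd | hd
    · exact (congrArg Rect.swap (h.swap.comm_of_lt_of_le (R₁ := R₁.swap) (R₂ := R₃.swap)
        (R₃ := R₂.swap) (R₄ := R₅.swap) (R₅ := R₄.swap) h₁ h₃ h₂ h₅ h₄ h13 h12 h35 h24 hd hb)).symm
    · have := h.pos
      have := h.width R₁ h₁
      have := h.height R₁ h₁
      have := h.width R₂ h₂
      have := h.height R₂ h₂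
      have := h.width R₃ h₃
      have := h.height R₃ h₃
      have := h.height R₄ h₄
      have := h.width R₅ h₅
      simp only [UpOf, RightOf] at h12 h13 h24 h35
      -- Here `R₂` and `R₃` reach at least as far as `R₁`, but by less than `k` more, so both tiles
      -- contain this point.
      exact h.eq_of_mem R₄ h₄ R₅ h₅ (R₁.b + k) (R₁.d + k) (by simp only [Mem]; omega)
        (by simp only [Mem]; omega)

/-- If `R₂` ends below row `j`, its upper neighbour is flush with the right side of `R₁` by
`left_eq`, and its height `k` suffices to cover the rest of that side. -/
theorem eq_or_upOf_of_mem (h : IsLinedUpTiling k T) {R₁ R₂ R : Rect} (h₁ : R₁ ∈ T)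
    (h₂ : R₂ ∈ T) (hR : R ∈ T) (h12 : RightOf k R₁ R₂) {j : ℤ} (hj : R₂.c ≤ j)
    (hj1 : j ≤ R₁.d) (hm : R.Mem (R₁.b + 1) j) : R = R₂ ∨ UpOf k R₂ R := by
  have := h.pos
  have := h.width R₂ h₂
  have := h.height R₁ h₁
  rcases le_or_gt j R₂.d with hjd | hjd
  · left
    refine h.eq_of_mem R hR R₂ h₂ _ _ hm ?_
    simp only [RightOf, Mem] at h12 ⊢
    omega
  · right
    obtain ⟨R₄, h₄, h24⟩ := h.up R₂ h₂
    have h4a := h.left_eq h₁ h₂ h₄ h12 h24 (by omega)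
    have := h.width R₄ h₄
    have := h.height R₄ h₄
    convert h24 using 1
    refine h.eq_of_mem R hR R₄ h₄ _ _ hm ?_
    simp only [RightOf, UpOf, Mem] at h12 h24 ⊢
    omega

/-- A tile which touches `R₁` on the right is the right neighbour of `R₁` or the upper or lower
neighbour of the latter. -/
theorem right_adjacent (h : IsLinedUpTiling k T) {R₁ R₂ R : Rect} (h₁ : R₁ ∈ T)
    (h₂ : R₂ ∈ T) (hR : R ∈ T) (h12 : RightOf k R₁ R₂) {j : ℤ} (hj : R₁.c ≤ j)
    (hj1 : j ≤ R₁.d) (hm : R.Mem (R₁.b + 1) j) : R = R₂ ∨ UpOf k R₂ R ∨ UpOf k R R₂ := by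
  rcases le_or_gt R₂.c j with hjc | hjc
  · exact (h.eq_or_upOf_of_mem h₁ h₂ hR h12 hjc hj1 hm).imp_right Or.inl
  · have key := h.flip.eq_or_upOf_of_mem (R₁ := R₁.flip) (R₂ := R₂.flip) (R := R.flip) (j := -j)
      (by rwa [Set.mem_preimage, Rect.flip_flip]) (by rwa [Set.mem_preimage, Rect.flip_flip])
      (by rwa [Set.mem_preimage, Rect.flip_flip])
      (by simp only [RightOf, Rect.flip] at h12 ⊢; omega)
      (by
        have := h.pos
        have := h.height R₁ h₁
        simp only [RightOf, Rect.flip] at h12 ⊢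
        omega) (by simp only [Rect.flip]; omega)
      (by simp only [Mem, Rect.flip] at hm ⊢; omega)
    rcases key with key | key
    · left
      have := congrArg Rect.flip key
      rwa [Rect.flip_flip, Rect.flip_flip] at this
    · right
      right
      simp only [UpOf, Rect.flip] at key ⊢
      omega

theorem up_adjacent (h : IsLinedUpTiling k T) {R₁ R₂ R : Rect} (h₁ : R₁ ∈ T)
    (h₂ : R₂ ∈ T) (hR : R ∈ T) (h12 : UpOf k R₁ R₂) {i : ℤ} (hi : R₁.a ≤ i)
    (hi1 : i ≤ R₁.b) (hm : R.Mem i (R₁.d + 1)) :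
    R = R₂ ∨ RightOf k R₂ R ∨ RightOf k R R₂ :=
  (h.swap.right_adjacent (R₁ := R₁.swap) (R₂ := R₂.swap) (R := R.swap) h₁ h₂ hR h12 hi hi1
    hm.symm).imp_left (congrArg Rect.swap)

/-- A property of tiles which is invariant under passing to neighbours holds for all tiles if it
holds for one of them. -/
theorem forall_of_invariant (h : IsLinedUpTiling k T) {P : Rect → Prop}
    (hright : ∀ R ∈ T, ∀ S ∈ T, RightOf k R S → (P R ↔ P S))
    (hup : ∀ R ∈ T, ∀ S ∈ T, UpOf k R S → (P R ↔ P S)) {R : Rect} (hR : R ∈ T) (hPR : P R) :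
    ∀ S ∈ T, P S := by
  -- One lattice step across a side leads to the right neighbour or to a tile above or below it, so
  -- neighbour steps realise every lattice step.
  have stepx : ∀ R ∈ T, ∀ S ∈ T, ∀ i j, R.Mem i j → S.Mem (i + 1) j → (P R ↔ P S) := by
    intro R hR S hS i j hRm hSm
    by_cases hi : i + 1 ≤ R.b
    · rw [h.eq_of_mem R hR S hS (i + 1) j (by simp only [Mem] at hRm ⊢; omega) hSm]
    · obtain rfl : i = R.b := by simp only [Mem] at hRm; omega
      obtain ⟨R₂, h₂, h12⟩ := h.right R hR
      rw [hright R hR R₂ h₂ h12]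
      rcases h.right_adjacent hR h₂ hS h12 hRm.2.1 hRm.2.2 hSm with rfl | h' | h'
      · rfl
      · exact hup _ h₂ _ hS h'
      · exact (hup _ hS _ h₂ h').symm
  have stepy : ∀ R ∈ T, ∀ S ∈ T, ∀ i j, R.Mem i j → S.Mem i (j + 1) → (P R ↔ P S) := by
    intro R hR S hS i j hRm hSm
    by_cases hj : j + 1 ≤ R.d
    · rw [h.eq_of_mem R hR S hS i (j + 1) (by simp only [Mem] at hRm ⊢; omega) hSm]
    · obtain rfl : j = R.d := by simp only [Mem] at hRm; omega
      obtain ⟨R₂, h₂, h12⟩ := h.up R hR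
      rw [hup R hR R₂ h₂ h12]
      rcases h.up_adjacent hR h₂ hS h12 hRm.1.1 hRm.1.2 hSm with rfl | h' | h'
      · rfl
      · exact hright _ h₂ _ hS h'
      · exact (hright _ hS _ h₂ h').symm
  choose t ht htm using h.exists_mem
  have hx : ∀ j i, P (t (i + 1) j) ↔ P (t i j) := fun j i =>
    (stepx _ (ht _ _) _ (ht _ _) i j (htm _ _) (htm _ _)).symm
  have hy : ∀ i j, P (t i (j + 1)) ↔ P (t i j) := fun i j =>
    (stepy _ (ht _ _) _ (ht _ _) i j (htm _ _) (htm _ _)).symm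
  have hconst : ∀ Q : ℤ → Prop, (∀ i, Q (i + 1) ↔ Q i) → ∀ i, Q i ↔ Q 0 := by
    intro Q hQ i
    induction i with
    | zero => rfl
    | succ i ih => rw [hQ, ih]
    | pred i ih =>
      rw [← ih, ← hQ (-i - 1), sub_add_cancel]
  have hall : ∀ i j, P (t i j) ↔ P (t 0 0) := fun i j =>
    (hconst (fun i => P (t i j)) (hx j) i).trans (hconst (fun j => P (t 0 j)) (hy 0) j)
  have hcorner : ∀ S ∈ T, t S.a S.c = S := fun S hS => by
    refine h.eq_of_mem _ (ht _ _) S hS S.a S.c (htm _ _) ?_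
    have := h.pos
    have := h.width S hS
    have := h.height S hS
    simp only [Mem]
    omega
  intro S hS
  rw [← hcorner S hS, hall, ← hall R.a R.c, hcorner R hR]
  exact hPR

end IsLinedUpTiling

/-! ### Actions generated by two commuting permutations. -/

/-- The action of `ℤ²` generated by two commuting permutations. -/
abbrev Commute.zsqAction {Y : Type*} {r u : Equiv.Perm Y} (h : Commute r u) :
    AddAction ZSq Y where
  vadd g y := (r ^ g.1 * u ^ g.2) y
  zero_vadd y := by
    change (r ^ (0 : ℤ) * u ^ (0 : ℤ)) y = y
    simp
  add_vadd g g' y := by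
    change (r ^ (g.1 + g'.1) * u ^ (g.2 + g'.2)) y
      = (r ^ g.1 * u ^ g.2) ((r ^ g'.1 * u ^ g'.2) y)
    rw [← Equiv.Perm.mul_apply, zpow_add, zpow_add]
    congr 1
    rw [mul_assoc, mul_assoc, ← mul_assoc (r ^ g'.1), ← mul_assoc (u ^ g.2),
      ((h.zpow_zpow g'.1 g.2)).eq]

/-- A permutation of `M` moves points within their orbits, and does so continuously. -/
def HasContinuousDisplacement {M : Set FZSq} (g : Equiv.Perm M) : Prop :=
  ∃ d : M → ZSq, Continuous d ∧ ∀ z, (g z : FZSq) = d z +ᵥ (z : FZSq)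

namespace HasContinuousDisplacement

variable {M : Set FZSq} {g g' : Equiv.Perm M}

theorem continuous_vadd_coe {d : M → ZSq} (hd : Continuous d) :
    Continuous fun z : M => d z +ᵥ (z : FZSq) := by
  refine continuous_iff_continuousAt.2 fun y => ?_
  have hev : (fun z : M => d y +ᵥ (z : FZSq)) =ᶠ[nhds y] fun z => d z +ᵥ (z : FZSq) := by
    filter_upwards [hd.continuousAt.preimage_mem_nhds
      ((isOpen_discrete {d y}).mem_nhds rfl)] with z hz
    have hz : d z = d y := hz
    rw [hz]
  exact ((FZSq.continuous_vadd (d y)).comp continuous_subtype_val).continuousAt.congr hev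

theorem one : HasContinuousDisplacement (1 : Equiv.Perm M) :=
  ⟨fun _ => 0, continuous_const, fun z => by simp⟩

theorem mul (h : HasContinuousDisplacement g) (h' : HasContinuousDisplacement g') :
    HasContinuousDisplacement (g * g') := by
  obtain ⟨d, hd, hg⟩ := h
  obtain ⟨d', hd', hg'⟩ := h'
  have hc : Continuous g' := by
    rw [continuous_induced_rng]
    exact (continuous_vadd_coe hd').congr fun z => (hg' z).symm
  refine ⟨fun z => d (g' z) + d' z, (hd.comp hc).add hd', fun z => ?_⟩
  rw [Equiv.Perm.mul_apply, hg, hg', add_vadd]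

theorem zpow (h : HasContinuousDisplacement g) (h' : HasContinuousDisplacement g⁻¹) (m : ℤ) :
    HasContinuousDisplacement (g ^ m) := by
  have hpow : ∀ {g : Equiv.Perm M}, HasContinuousDisplacement g → ∀ n : ℕ,
      HasContinuousDisplacement (g ^ n) := by
    intro g hg n
    induction n with
    | zero => exact one
    | succ n ih => exact pow_succ g n ▸ ih.mul hg
  obtain ⟨n, rfl | rfl⟩ := m.eq_nat_or_neg
  · rw [zpow_natCast]
    exact hpow h n
  · rw [zpow_neg, zpow_natCast, ← inv_pow]
    exact hpow h' n

end HasContinuousDisplacement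

/-- A permutation which moves every point by at least `k` in the first coordinate and by at most
`k - 1` in the second. -/
theorem exists_zpow_displacement {M : Set FZSq} {k : ℤ} {g : Equiv.Perm M} {p₁ p₂ : ZSq →+ ℤ}
    (hg : ∀ z, ∃ D : ZSq, (g z : FZSq) = D +ᵥ (z : FZSq) ∧ k ≤ p₁ D ∧ |p₂ D| ≤ k - 1) (m : ℤ)
    (z : M) : ∃ D : ZSq, ((g ^ m) z : FZSq) = D +ᵥ (z : FZSq) ∧ k * |m| ≤ |p₁ D| ∧
      |p₂ D| ≤ (k - 1) * |m| := by
  have hnat : ∀ (n : ℕ) (z : M), ∃ D : ZSq, ((g ^ n) z : FZSq) = D +ᵥ (z : FZSq) ∧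
      k * n ≤ p₁ D ∧ |p₂ D| ≤ (k - 1) * n := by
    intro n
    induction n with
    | zero => exact fun z => ⟨0, by simp⟩
    | succ n ih =>
      intro z
      obtain ⟨D, h1, h2, h3⟩ := ih z
      obtain ⟨D', h1', h2', h3'⟩ := hg ((g ^ n) z)
      refine ⟨D' + D, ?_, ?_, ?_⟩
      · rw [pow_succ', Equiv.Perm.mul_apply, h1', h1, add_vadd]
      · rw [map_add]
        push_cast
        linarith
      · rw [map_add]
        have := abs_add_le (p₂ D') (p₂ D)
        push_cast
        linarith
  obtain ⟨n, rfl | rfl⟩ := m.eq_nat_or_neg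
  · obtain ⟨D, h1, h2, h3⟩ := hnat n z
    refine ⟨D, by rwa [zpow_natCast], ?_, ?_⟩
    · rw [Nat.abs_cast]
      exact h2.trans (le_abs_self _)
    · rwa [Nat.abs_cast]
  · obtain ⟨D, h1, h2, h3⟩ := hnat n ((g ^ (-n : ℤ)) z)
    refine ⟨-D, ?_, ?_, ?_⟩
    · rw [← zpow_natCast, ← Equiv.Perm.mul_apply, ← zpow_add, add_neg_cancel, zpow_zero,
        Equiv.Perm.one_apply] at h1
      rw [h1, neg_vadd_vadd]
    · rw [abs_neg, Nat.abs_cast, map_neg, abs_neg]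
      exact h2.trans (le_abs_self _)
    · rwa [abs_neg, Nat.abs_cast, map_neg, abs_neg]

theorem Commute.isFreeAction_zsqAction {M : Set FZSq} {k : ℤ} {r u : Equiv.Perm M}
    (h : Commute r u)
    (hr : ∀ z, ∃ D : ZSq, (r z : FZSq) = D +ᵥ (z : FZSq) ∧ k ≤ D.1 ∧ |D.2| ≤ k - 1)
    (hu : ∀ z, ∃ D : ZSq, (u z : FZSq) = D +ᵥ (z : FZSq) ∧ k ≤ D.2 ∧ |D.1| ≤ k - 1) :
    IsFreeAction h.zsqAction := by
  rintro ⟨m, n⟩ hmn z hz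
  have hz : (r ^ m) ((u ^ n) z) = z := hz
  have hz' : (u ^ n) z = (r ^ (-m)) z := by
    rw [zpow_neg, Equiv.Perm.eq_inv_iff_eq, hz]
  obtain ⟨D, h1, h2, h3⟩ := exists_zpow_displacement (p₁ := AddMonoidHom.fst ℤ ℤ)
    (p₂ := AddMonoidHom.snd ℤ ℤ) hr (-m) z
  obtain ⟨D', h1', h2', h3'⟩ := exists_zpow_displacement (p₁ := AddMonoidHom.snd ℤ ℤ)
    (p₂ := AddMonoidHom.fst ℤ ℤ) hu n z
  have hD : D' = D := by
    refine freePart.vadd_left_injective (z : FZSq) ?_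
    change D' +ᵥ (z : FZSq) = D +ᵥ (z : FZSq)
    rw [← h1, ← h1', hz']
  subst hD
  rw [abs_neg] at h2 h3
  simp only [AddMonoidHom.coe_fst, AddMonoidHom.coe_snd] at h2 h3 h2' h3'
  have hm0 := abs_nonneg m
  have hn0 := abs_nonneg n
  -- The bounds `k * |m| ≤ (k - 1) * |n|` and `k * |n| ≤ (k - 1) * |m|` add up to `|m| + |n| ≤ 0`.
  have hm : |m| = 0 := by nlinarith
  have hn : |n| = 0 := by nlinarith
  exact hmn (by rw [abs_eq_zero.1 hm, abs_eq_zero.1 hn]; rfl)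

/-- The cocycle of the action generated by two commuting permutations with continuous
displacement is continuous. -/
theorem Commute.exists_continuous_cocycle {M : Set FZSq} {r u : Equiv.Perm M} (h : Commute r u)
    (hr : HasContinuousDisplacement r) (hr' : HasContinuousDisplacement r⁻¹)
    (hu : HasContinuousDisplacement u) (hu' : HasContinuousDisplacement u⁻¹) :
    ∃ φ : ZSq × M → ZSq, Continuous φ ∧ ∀ (g : ZSq) (y : M),
      ((h.zsqAction.vadd g y : M) : FZSq) = φ (g, y) +ᵥ (y : FZSq) := by
  choose d hd hdv using fun g : ZSq => (hr.zpow hr' g.1).mul (hu.zpow hu' g.2)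
  exact ⟨fun p => d p.1 p.2, continuous_prod_of_discrete_left.2 hd, fun g y => hdv g y⟩

/-! ### From classes of the tiling to rectangles in the lattice. -/

namespace Rect

/-- The points of the orbit of `y` in the rectangle with coordinates relative to `y`. -/
def toSet (R : Rect) (y : FZSq) : Set FZSq := {z | ∃ i j, R.Mem i j ∧ z = ((i, j) : ZSq) +ᵥ y}

theorem vadd_mem_toSet {R : Rect} {y : FZSq} {u : ZSq} :
    u +ᵥ y ∈ R.toSet y ↔ R.Mem u.1 u.2 := by
  refine ⟨?_, fun h => ⟨u.1, u.2, h, rfl⟩⟩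
  rintro ⟨i, j, hm, hij⟩
  rw [freePart.vadd_left_injective y hij]
  exact hm

theorem toSet_translate (R : Rect) (g : ZSq) (y : FZSq) :
    (R.translate g).toSet y = R.toSet (g +ᵥ y) := by
  ext z
  constructor
  · rintro ⟨i, j, hm, rfl⟩
    refine ⟨i - g.1, j - g.2, ?_, ?_⟩
    · simp only [Mem, translate] at hm ⊢
      omega
    · rw [← add_vadd]
      congr 1
      exact Prod.ext (by simp) (by simp)
  · rintro ⟨i, j, hm, rfl⟩
    refine ⟨i + g.1, j + g.2, ?_, ?_⟩
    · simp only [Mem, translate] at hm ⊢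
      omega
    · rw [← add_vadd]
      rfl

theorem isRectangleAt_toSet {R : Rect} (y : FZSq) (h : R.a < R.b) (h' : R.c < R.d) :
    IsRectangleAt (R.toSet y) y R.a R.b R.c R.d := by
  refine ⟨h, h', ?_⟩
  ext z
  simp only [toSet, Mem, Set.mem_Icc, and_assoc, Set.mem_ofPred_eq]

theorem translate_translate_neg (R : Rect) (g : ZSq) : (R.translate (-g)).translate g = R := by
  ext <;> simp [translate]

end Rect

/-- The rectangles of the tiling `E` of the orbit of `y`, in coordinates relative to `y`. -/
def tiles (E : Setoid FZSq) (y : FZSq) : Set Rect :=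
  {R | (R.a < R.b ∧ R.c < R.d) ∧ R.toSet y ∈ E.classes}

theorem mem_tiles_vadd {E : Setoid FZSq} {y : FZSq} {g : ZSq} {R : Rect} :
    R ∈ tiles E (g +ᵥ y) ↔ R.translate g ∈ tiles E y := by
  simp only [tiles, Set.mem_ofPred_eq, Rect.toSet_translate]
  simp [Rect.translate]

namespace IsRectangularTiling

open Rect

variable {E : Setoid FZSq}

theorem exists_tile (hE : IsRectangularTiling E) {C : Set FZSq} (hC : C ∈ E.classes) {u : ZSq}
    {y : FZSq} (hu : u +ᵥ y ∈ C) : ∃ R ∈ tiles E y, R.toSet y = C := by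
  obtain ⟨x, a, b, c, d, hab, hcd, rfl⟩ := hE.2 C hC
  obtain ⟨i, j, -, -, hij⟩ := hu
  obtain ⟨w, rfl⟩ : ∃ w : ZSq, x = w +ᵥ y :=
    ⟨-(i, j) + u, by rw [add_vadd, hij, neg_vadd_vadd]⟩
  have hset : ((⟨a, b, c, d⟩ : Rect).translate w).toSet y
      = {z | ∃ i j : ℤ, i ∈ Set.Icc a b ∧ j ∈ Set.Icc c d ∧ z = ((i, j) : ZSq) +ᵥ (w +ᵥ y)} := by
    rw [toSet_translate]
    exact (isRectangleAt_toSet (w +ᵥ y) (R := ⟨a, b, c, d⟩) hab hcd).2.2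
  refine ⟨(⟨a, b, c, d⟩ : Rect).translate w, ⟨?_, hset ▸ hC⟩, hset⟩
  simp only [Rect.translate]
  omega

theorem exists_tile_mem (hE : IsRectangularTiling E) (y : FZSq) (i j : ℤ) :
    ∃ R ∈ tiles E y, R.Mem i j := by
  obtain ⟨R, hR, hRC⟩ := hE.exists_tile (u := (i, j)) (y := y)
    (E.mem_classes (((i, j) : ZSq) +ᵥ y)) (E.refl _)
  refine ⟨R, hR, vadd_mem_toSet (u := (i, j)) (y := y) |>.1 ?_⟩
  rw [hRC]
  exact E.refl _

theorem eq_of_toSet_eq {R S : Rect} {y : FZSq} (hR : R ∈ tiles E y) (hS : S ∈ tiles E y)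
    (h : R.toSet y = S.toSet y) : R = S := by
  have key : ∀ i j, R.Mem i j ↔ S.Mem i j := fun i j => by
    rw [← vadd_mem_toSet (u := (i, j)) (y := y), h, vadd_mem_toSet]
  have hR := hR.1
  have hS := hS.1
  have h1 := key R.a R.c
  have h2 := key R.b R.d
  have h3 := key S.a S.c
  have h4 := key S.b S.d
  simp only [Mem] at h1 h2 h3 h4
  ext <;> omega

theorem tile_eq_of_mem {R S : Rect} {y : FZSq} (hR : R ∈ tiles E y) (hS : S ∈ tiles E y)
    {i j : ℤ} (h : R.Mem i j) (h' : S.Mem i j) : R = S :=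
  eq_of_toSet_eq hR hS (Setoid.eq_of_mem_classes hR.2
    ((vadd_mem_toSet (u := (i, j)) (y := y)).2 h) hS.2
    ((vadd_mem_toSet (u := (i, j)) (y := y)).2 h'))

theorem rel_iff_mem {R : Rect} {y : FZSq} (hR : R ∈ tiles E y) {u v : ZSq}
    (hu : R.Mem u.1 u.2) : E (u +ᵥ y) (v +ᵥ y) ↔ R.Mem v.1 v.2 := by
  rw [Setoid.rel_iff_exists_classes, ← vadd_mem_toSet (y := y)]
  refine ⟨?_, fun h => ⟨_, hR.2, vadd_mem_toSet.2 hu, h⟩⟩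
  rintro ⟨C, hC, huC, hvC⟩
  rwa [← Setoid.eq_of_mem_classes hC huC hR.2 (vadd_mem_toSet.2 hu)]

/-- The tile through `(R.a, R.c)` is `R` exactly when it contains `(R.b, R.d)` and omits four points
just beyond the ends of the bottom and left sides. These are finitely many clopen conditions. -/
theorem isOpen_mem_tiles (hE : IsRectangularTiling E) (hcl : IsClopenRel E) (R : Rect) :
    IsOpen {y : FZSq | R ∈ tiles E y} := by
  by_cases hR : R.a < R.b ∧ R.c < R.d
  · have hrel : ∀ u v : ZSq, IsClopen {y : FZSq | E (u +ᵥ y) (v +ᵥ y)} := by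
      intro u v
      have := (hcl (v - u)).preimage (FZSq.continuous_vadd u)
      simpa only [Set.preimage, Set.mem_ofPred_eq, ← add_vadd, sub_add_cancel] using this
    have heq : {y : FZSq | R ∈ tiles E y} =
        {y : FZSq | E (((R.a, R.c) : ZSq) +ᵥ y) (((R.b, R.d) : ZSq) +ᵥ y)} ∩
        ({y : FZSq | E (((R.a, R.c) : ZSq) +ᵥ y) (((R.a - 1, R.c) : ZSq) +ᵥ y)}ᶜ ∩
        ({y : FZSq | E (((R.a, R.c) : ZSq) +ᵥ y) (((R.b + 1, R.c) : ZSq) +ᵥ y)}ᶜ ∩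
        ({y : FZSq | E (((R.a, R.c) : ZSq) +ᵥ y) (((R.a, R.c - 1) : ZSq) +ᵥ y)}ᶜ ∩
        {y : FZSq | E (((R.a, R.c) : ZSq) +ᵥ y) (((R.a, R.d + 1) : ZSq) +ᵥ y)}ᶜ))) := by
      ext y
      simp only [Set.mem_inter_iff, Set.mem_compl_iff, Set.mem_ofPred_eq]
      obtain ⟨S, hS, hSm⟩ := hE.exists_tile_mem y R.a R.c
      simp only [rel_iff_mem hS (u := (R.a, R.c)) hSm]
      constructor
      · intro h
        obtain rfl : R = S := tile_eq_of_mem h hS (by simp only [Mem]; omega) hSm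
        simp only [Mem]
        omega
      · intro h
        have : R = S := by
          simp only [Mem] at h hSm
          ext <;> omega
        rwa [this]
    rw [heq]
    exact ((hrel _ _).inter ((hrel _ _).compl.inter ((hrel _ _).compl.inter
      ((hrel _ _).compl.inter (hrel _ _).compl)))).isOpen
  · have : {y : FZSq | R ∈ tiles E y} = ∅ := Set.eq_empty_of_forall_notMem fun y hy => hR hy.1
    rw [this]
    exact isOpen_empty

end IsRectangularTiling

theorem ncard_le_of_subset_image_Icc {A : Set FZSq} {f : ℤ → FZSq} {lo hi : ℤ}
    (h : A ⊆ f '' Set.Icc lo hi) : A.ncard ≤ (hi + 1 - lo).toNat := by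
  refine (Set.ncard_le_ncard h ((Set.finite_Icc _ _).image _)).trans
    ((Set.ncard_image_le (Set.finite_Icc _ _)).trans ?_)
  rw [Set.ncard_eq_toFinset_card', Set.toFinset_Icc, Int.card_Icc]

namespace IsRectangularTiling

open Rect

variable {E : Setoid FZSq}

/-- All overlap points lie in column `R.b`, in the common rows of the two tiles, so their number
bounds the length of that interval. -/
theorem rightOf_of_overlap {R S : Rect} {y : FZSq} {k : ℕ} (hk : 1 ≤ k)
    (hR : R ∈ tiles E y) (hS : S ∈ tiles E y) (hne : R ≠ S)
    (h : k ≤ overlap (1, 0) (R.toSet y) (S.toSet y)) : RightOf k R S ∧ k ≤ R.d - R.c + 1 := by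
  have hsub : ∀ z ∈ {z ∈ R.toSet y | ((1, 0) : ZSq) +ᵥ z ∈ S.toSet y}, S.a = R.b + 1 ∧
      ∃ j : ℤ, (max R.c S.c ≤ j ∧ j ≤ min R.d S.d) ∧ ((R.b, j) : ZSq) +ᵥ y = z := by
    rintro _ ⟨⟨i, j, hm, rfl⟩, hz⟩
    rw [← add_vadd, vadd_mem_toSet] at hz
    have h1 : ¬ R.Mem (1 + i) (0 + j) := fun h1 => hne (tile_eq_of_mem hR hS h1 hz)
    have h2 : ¬ S.Mem i j := fun h2 => hne (tile_eq_of_mem hR hS hm h2)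
    simp only [Mem, Prod.mk_add_mk] at h1 h2 hm hz
    obtain rfl : i = R.b := by omega
    exact ⟨by omega, j, by omega, rfl⟩
  have hcard := h.trans (ncard_le_of_subset_image_Icc (f := fun j => ((R.b, j) : ZSq) +ᵥ y)
    fun z hz => (hsub z hz).2)
  obtain ⟨z, hz⟩ : {z ∈ R.toSet y | ((1, 0) : ZSq) +ᵥ z ∈ S.toSet y}.Nonempty :=
    Set.nonempty_of_ncard_ne_zero (by rw [overlap] at h; omega)
  exact ⟨⟨(hsub z hz).1, by omega, by omega⟩, by omega⟩

theorem leftOf_of_overlap {R S : Rect} {y : FZSq} {k : ℕ} (hk : 1 ≤ k)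
    (hR : R ∈ tiles E y) (hS : S ∈ tiles E y) (hne : R ≠ S)
    (h : k ≤ overlap (-1, 0) (R.toSet y) (S.toSet y)) : RightOf k S R := by
  have hsub : ∀ z ∈ {z ∈ R.toSet y | ((-1, 0) : ZSq) +ᵥ z ∈ S.toSet y}, R.a = S.b + 1 ∧
      ∃ j : ℤ, (max R.c S.c ≤ j ∧ j ≤ min R.d S.d) ∧ ((R.a, j) : ZSq) +ᵥ y = z := by
    rintro _ ⟨⟨i, j, hm, rfl⟩, hz⟩
    rw [← add_vadd, vadd_mem_toSet] at hz
    have h1 : ¬ R.Mem (-1 + i) (0 + j) := fun h1 => hne (tile_eq_of_mem hR hS h1 hz)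
    have h2 : ¬ S.Mem i j := fun h2 => hne (tile_eq_of_mem hR hS hm h2)
    simp only [Mem, Prod.mk_add_mk] at h1 h2 hm hz
    obtain rfl : i = R.a := by omega
    exact ⟨by omega, j, by omega, rfl⟩
  have hcard := h.trans (ncard_le_of_subset_image_Icc (f := fun j => ((R.a, j) : ZSq) +ᵥ y)
    fun z hz => (hsub z hz).2)
  obtain ⟨z, hz⟩ : {z ∈ R.toSet y | ((-1, 0) : ZSq) +ᵥ z ∈ S.toSet y}.Nonempty :=
    Set.nonempty_of_ncard_ne_zero (by rw [overlap] at h; omega)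
  exact ⟨(hsub z hz).1, by omega, by omega⟩

theorem upOf_of_overlap {R S : Rect} {y : FZSq} {k : ℕ} (hk : 1 ≤ k)
    (hR : R ∈ tiles E y) (hS : S ∈ tiles E y) (hne : R ≠ S)
    (h : k ≤ overlap (0, 1) (R.toSet y) (S.toSet y)) : UpOf k R S ∧ k ≤ R.b - R.a + 1 := by
  have hsub : ∀ z ∈ {z ∈ R.toSet y | ((0, 1) : ZSq) +ᵥ z ∈ S.toSet y}, S.c = R.d + 1 ∧
      ∃ i : ℤ, (max R.a S.a ≤ i ∧ i ≤ min R.b S.b) ∧ ((i, R.d) : ZSq) +ᵥ y = z := by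
    rintro _ ⟨⟨i, j, hm, rfl⟩, hz⟩
    rw [← add_vadd, vadd_mem_toSet] at hz
    have h1 : ¬ R.Mem (0 + i) (1 + j) := fun h1 => hne (tile_eq_of_mem hR hS h1 hz)
    have h2 : ¬ S.Mem i j := fun h2 => hne (tile_eq_of_mem hR hS hm h2)
    simp only [Mem, Prod.mk_add_mk] at h1 h2 hm hz
    obtain rfl : j = R.d := by omega
    exact ⟨by omega, i, by omega, rfl⟩
  have hcard := h.trans (ncard_le_of_subset_image_Icc (f := fun i => ((i, R.d) : ZSq) +ᵥ y)
    fun z hz => (hsub z hz).2)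
  obtain ⟨z, hz⟩ : {z ∈ R.toSet y | ((0, 1) : ZSq) +ᵥ z ∈ S.toSet y}.Nonempty :=
    Set.nonempty_of_ncard_ne_zero (by rw [overlap] at h; omega)
  exact ⟨⟨(hsub z hz).1, by omega, by omega⟩, by omega⟩

theorem downOf_of_overlap {R S : Rect} {y : FZSq} {k : ℕ} (hk : 1 ≤ k)
    (hR : R ∈ tiles E y) (hS : S ∈ tiles E y) (hne : R ≠ S)
    (h : k ≤ overlap (0, -1) (R.toSet y) (S.toSet y)) : UpOf k S R := by
  have hsub : ∀ z ∈ {z ∈ R.toSet y | ((0, -1) : ZSq) +ᵥ z ∈ S.toSet y}, R.c = S.d + 1 ∧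
      ∃ i : ℤ, (max R.a S.a ≤ i ∧ i ≤ min R.b S.b) ∧ ((i, R.c) : ZSq) +ᵥ y = z := by
    rintro _ ⟨⟨i, j, hm, rfl⟩, hz⟩
    rw [← add_vadd, vadd_mem_toSet] at hz
    have h1 : ¬ R.Mem (0 + i) (-1 + j) := fun h1 => hne (tile_eq_of_mem hR hS h1 hz)
    have h2 : ¬ S.Mem i j := fun h2 => hne (tile_eq_of_mem hR hS hm h2)
    simp only [Mem, Prod.mk_add_mk] at h1 h2 hm hz
    obtain rfl : j = R.c := by omega
    exact ⟨by omega, i, by omega, rfl⟩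
  have hcard := h.trans (ncard_le_of_subset_image_Icc (f := fun i => ((i, R.c) : ZSq) +ᵥ y)
    fun z hz => (hsub z hz).2)
  obtain ⟨z, hz⟩ : {z ∈ R.toSet y | ((0, -1) : ZSq) +ᵥ z ∈ S.toSet y}.Nonempty :=
    Set.nonempty_of_ncard_ne_zero (by rw [overlap] at h; omega)
  exact ⟨(hsub z hz).1, by omega, by omega⟩

/-- Each orbit of an almost lined-up tiling is a lined-up tiling of the lattice. -/
theorem exists_isLinedUpTiling (hE : IsRectangularTiling E) (hlu : IsAlmostLinedUp E) :
    ∃ k : ℤ, ∀ y, IsLinedUpTiling k (tiles E y) := by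
  obtain ⟨M, hM, hdir⟩ := hlu
  have hnb : ∀ e ∈ ({(1, 0), (-1, 0), (0, 1), (0, -1)} : Set ZSq), ∀ y, ∀ R ∈ tiles E y,
      ∃ S ∈ tiles E y, R ≠ S ∧ M / 2 + 1 ≤ overlap e (R.toSet y) (S.toSet y) := by
    intro e he y R hR
    obtain ⟨C, hC, ⟨hne, z, ⟨i, j, hm, rfl⟩, hz⟩, hov⟩ := hdir e he _ hR.2
    rw [← add_vadd] at hz
    obtain ⟨S, hS, rfl⟩ := hE.exists_tile hC hz
    refine ⟨S, hS, fun h => hne (h ▸ rfl), ?_⟩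
    have : (M : ℝ) < ((overlap e (R.toSet y) (S.toSet y) * 2 : ℕ) : ℝ) := by
      push_cast
      linarith
    have := Nat.cast_lt.1 this
    omega
  have hsize : ∀ y, ∀ R ∈ tiles E y, R.b - R.a + 1 ≤ M ∧ R.d - R.c + 1 ≤ M := fun y R hR =>
    hM _ hR.2 y _ _ _ _ (isRectangleAt_toSet y hR.1.1 hR.1.2)
  -- This is the least integer above `M / 2`, and `M ≤ 2 * k - 1`. Each side has length at least `k`
  -- because it contains an overlap.
  refine ⟨(M / 2 + 1 : ℕ), fun y => ⟨by omega, fun R hR S hS i j => tile_eq_of_mem hR hS,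
    hE.exists_tile_mem y, fun R hR => ⟨?_, ?_⟩, fun R hR => ⟨?_, ?_⟩,
    fun R hR => ?_, fun R hR => ?_, fun R hR => ?_, fun R hR => ?_⟩⟩
  · obtain ⟨S, hS, hne, h⟩ := hnb (0, 1) (by simp) y R hR
    exact (upOf_of_overlap (by omega) hR hS hne h).2
  · have := hsize y R hR
    omega
  · obtain ⟨S, hS, hne, h⟩ := hnb (1, 0) (by simp) y R hR
    exact (rightOf_of_overlap (by omega) hR hS hne h).2
  · have := hsize y R hR
    omega
  · obtain ⟨S, hS, hne, h⟩ := hnb (1, 0) (by simp) y R hR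
    exact ⟨S, hS, (rightOf_of_overlap (by omega) hR hS hne h).1⟩
  · obtain ⟨S, hS, hne, h⟩ := hnb (-1, 0) (by simp) y R hR
    exact ⟨S, hS, leftOf_of_overlap (by omega) hR hS hne h⟩
  · obtain ⟨S, hS, hne, h⟩ := hnb (0, 1) (by simp) y R hR
    exact ⟨S, hS, (upOf_of_overlap (by omega) hR hS hne h).1⟩
  · obtain ⟨S, hS, hne, h⟩ := hnb (0, -1) (by simp) y R hR
    exact ⟨S, hS, downOf_of_overlap (by omega) hR hS hne h⟩

/-! ### The section of lower left corners and its neighbour maps. -/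

/-- The lower left corners of the tiles. -/
def corners (E : Setoid FZSq) : Set FZSq := {y | ∃ R ∈ tiles E y, R.a = 0 ∧ R.c = 0}

theorem corner_mem_corners {R : Rect} {y : FZSq} (hR : R ∈ tiles E y) :
    ((R.a, R.c) : ZSq) +ᵥ y ∈ corners E := by
  refine ⟨R.translate (-(R.a, R.c)), ?_, ?_⟩
  · rwa [mem_tiles_vadd, translate_translate_neg]
  · simp [Rect.translate]

theorem vadd_mem_corners {g : ZSq} {y : FZSq} (h : g +ᵥ y ∈ corners E) :
    ∃ R ∈ tiles E y, R.a = g.1 ∧ R.c = g.2 := by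
  obtain ⟨R, hR, ha, hc⟩ := h
  exact ⟨R.translate g, mem_tiles_vadd.1 hR, by simp [Rect.translate, ha],
    by simp [Rect.translate, hc]⟩

theorem isCompleteSection_corners (hE : IsRectangularTiling E) :
    IsCompleteSection ZSq (corners E) := by
  intro y
  obtain ⟨R, hR, -⟩ := hE.exists_tile_mem y 0 0
  exact ⟨_, corner_mem_corners hR, _, rfl⟩

theorem mem_corners_iff (hE : IsRectangularTiling E) {y : FZSq} :
    y ∈ corners E ↔ ¬ E y (((-1, 0) : ZSq) +ᵥ y) ∧ ¬ E y (((0, -1) : ZSq) +ᵥ y) := by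
  obtain ⟨R, hR, hm⟩ := hE.exists_tile_mem y 0 0
  have hrel : ∀ v : ZSq, E y (v +ᵥ y) ↔ R.Mem v.1 v.2 := fun v => by
    rw [← rel_iff_mem hR (u := (0, 0)) hm]
    rw [show ((0, 0) : ZSq) = 0 from rfl, zero_vadd]
  rw [hrel, hrel]
  constructor
  · rintro ⟨S, hS, ha, hc⟩
    have hS' := hS.1
    obtain rfl : R = S := tile_eq_of_mem hR hS hm (by simp only [Mem]; omega)
    simp only [Mem]
    omega
  · intro h
    refine ⟨R, hR, ?_⟩
    simp only [Mem] at hm h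
    omega

theorem isClopen_corners (hE : IsRectangularTiling E) (hcl : IsClopenRel E) :
    IsClopen (corners E) := by
  have : corners E = {y | E y (((-1, 0) : ZSq) +ᵥ y)}ᶜ ∩ {y | E y (((0, -1) : ZSq) +ᵥ y)}ᶜ := by
    ext y
    exact hE.mem_corners_iff
  rw [this]
  exact (hcl _).compl.inter (hcl _).compl

theorem isCoCompleteSection_corners (hE : IsRectangularTiling E) :
    IsCoCompleteSection ZSq (corners E) := by
  intro y
  obtain ⟨R, hR, hm⟩ := hE.exists_tile_mem y 0 0
  -- Tiles have width at least two, so the point to the right of a corner is in the same tile and is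
  -- no corner.
  refine ⟨((R.a + 1, R.c) : ZSq) +ᵥ y, fun h => ?_, _, rfl⟩
  have hR' := hR.1
  obtain ⟨S, hS, ha, hc⟩ := vadd_mem_corners h
  have hS' := hS.1
  simp only at ha hc
  have : R = S := tile_eq_of_mem hR hS (i := R.a + 1) (j := R.c) (by simp only [Mem]; omega)
    (by simp only [Mem]; omega)
  subst this
  omega

/-- A neighbour relation on tiles yields a map on corners with continuous displacement. -/
theorem exists_corner_step (hE : IsRectangularTiling E) (hcl : IsClopenRel E)
    {P : Rect → Rect → Prop} (htr : ∀ g R S, P (R.translate g) (S.translate g) ↔ P R S)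
    (hex : ∀ y, ∀ R ∈ tiles E y, ∃ S ∈ tiles E y, P R S)
    (huniq : ∀ y, ∀ R ∈ tiles E y, ∀ S ∈ tiles E y, ∀ S' ∈ tiles E y, P R S → P R S' → S = S') :
    ∃ d : corners E → ZSq, Continuous d ∧ ∀ y, ∀ R ∈ tiles E y, ∀ S ∈ tiles E y, P R S →
      ∀ z : corners E, (z : FZSq) = ((R.a, R.c) : ZSq) +ᵥ y →
        d z +ᵥ (z : FZSq) = ((S.a, S.c) : ZSq) +ᵥ y := by
  choose R hR hRa hRc using fun z : corners E => z.2
  choose S hS hRS using fun z : corners E => hex z (R z) (hR z)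
  have key : ∀ z : corners E, ∀ R' ∈ tiles E (z : FZSq), R'.a = 0 → R'.c = 0 →
      ∀ S' ∈ tiles E (z : FZSq), P R' S' → S z = S' := by
    intro z R' hR' ha hc S' hS' h
    have h1 := (hR z).1
    have h2 := hR'.1
    have h3 := hRa z
    have h4 := hRc z
    have : R z = R' := tile_eq_of_mem (hR z) hR' (i := 0) (j := 0) (by simp only [Mem]; omega)
      (by simp only [Mem]; omega)
    exact huniq z R' hR' (S z) (hS z) S' hS' (this ▸ hRS z) h
  refine ⟨fun z => ((S z).a, (S z).c), ?_, ?_⟩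
  · refine IsLocallyConstant.continuous ((IsLocallyConstant.iff_exists_open _).2 fun z => ?_)
    -- As long as `R z` and `S z` both remain tiles, uniqueness keeps the neighbour equal to `S z`.
    refine ⟨Subtype.val ⁻¹' ({y | R z ∈ tiles E y} ∩ {y | S z ∈ tiles E y}),
      ((hE.isOpen_mem_tiles hcl _).inter (hE.isOpen_mem_tiles hcl _)).preimage
        continuous_subtype_val, ⟨hR z, hS z⟩, fun z' hz' => ?_⟩
    rw [key z' (R z) hz'.1 (hRa z) (hRc z) (S z) hz'.2 (hRS z)]
  · intro y R' hR' S' hS' h z hz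
    have hmem : ∀ Q ∈ tiles E y, Q.translate (-(R'.a, R'.c)) ∈ tiles E (z : FZSq) := by
      intro Q hQ
      rwa [hz, mem_tiles_vadd, translate_translate_neg]
    simp only [key z _ (hmem R' hR') (by simp [Rect.translate]) (by simp [Rect.translate]) _
      (hmem S' hS') ((htr _ _ _).2 h)]
    rw [hz, ← add_vadd]
    congr 1
    exact Prod.ext (by simp [Rect.translate]) (by simp [Rect.translate])

/-- The steps along `P` and along its converse are mutually inverse. An abstract `P` serves the
right and the upper neighbours alike. -/
theorem exists_corner_perm (hE : IsRectangularTiling E) (hcl : IsClopenRel E)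
    {P : Rect → Rect → Prop} (htr : ∀ g R S, P (R.translate g) (S.translate g) ↔ P R S)
    (hex : ∀ y, ∀ R ∈ tiles E y, ∃ S ∈ tiles E y, P R S)
    (hex' : ∀ y, ∀ R ∈ tiles E y, ∃ S ∈ tiles E y, P S R)
    (huniq : ∀ y, ∀ R ∈ tiles E y, ∀ S ∈ tiles E y, ∀ S' ∈ tiles E y, P R S → P R S' → S = S')
    (huniq' : ∀ y, ∀ R ∈ tiles E y, ∀ S ∈ tiles E y, ∀ S' ∈ tiles E y,
      P S R → P S' R → S = S') :
    ∃ r : Equiv.Perm (corners E), HasContinuousDisplacement r ∧ HasContinuousDisplacement r⁻¹ ∧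
      ∀ y, ∀ R ∈ tiles E y, ∀ S ∈ tiles E y, P R S →
        ∀ z : corners E, (z : FZSq) = ((R.a, R.c) : ZSq) +ᵥ y →
          (r z : FZSq) = ((S.a, S.c) : ZSq) +ᵥ y := by
  obtain ⟨d, hd, hdP⟩ := hE.exists_corner_step hcl htr hex huniq
  obtain ⟨d', hd', hdP'⟩ := hE.exists_corner_step hcl (P := fun R S => P S R)
    (fun g R S => htr g S R) hex' huniq'
  have hself : ∀ {R : Rect} {z : corners E}, R.a = 0 ∧ R.c = 0 →
      (z : FZSq) = ((R.a, R.c) : ZSq) +ᵥ (z : FZSq) := by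
    intro R z h
    rw [h.1, h.2, show ((0, 0) : ZSq) = 0 from rfl, zero_vadd]
  have hm : ∀ z : corners E, d z +ᵥ (z : FZSq) ∈ corners E := by
    intro z
    obtain ⟨R, hR, h0⟩ := z.2
    obtain ⟨S, hS, hRS⟩ := hex z R hR
    rw [hdP z R hR S hS hRS z (hself h0)]
    exact corner_mem_corners hS
  have hm' : ∀ z : corners E, d' z +ᵥ (z : FZSq) ∈ corners E := by
    intro z
    obtain ⟨R, hR, h0⟩ := z.2
    obtain ⟨S, hS, hRS⟩ := hex' z R hR
    rw [hdP' z R hR S hS hRS z (hself h0)]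
    exact corner_mem_corners hS
  let r : Equiv.Perm (corners E) :=
    { toFun := fun z => ⟨d z +ᵥ (z : FZSq), hm z⟩
      invFun := fun z => ⟨d' z +ᵥ (z : FZSq), hm' z⟩
      left_inv := by
        intro z
        obtain ⟨R, hR, h0⟩ := z.2
        obtain ⟨S, hS, hRS⟩ := hex z R hR
        exact Subtype.ext ((hdP' z S hS R hR hRS _ (hdP z R hR S hS hRS z (hself h0))).trans
          (hself h0).symm)
      right_inv := by
        intro z
        obtain ⟨R, hR, h0⟩ := z.2
        obtain ⟨S, hS, hRS⟩ := hex' z R hR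
        exact Subtype.ext ((hdP z S hS R hR hRS _ (hdP' z R hR S hS hRS z (hself h0))).trans
          (hself h0).symm) }
  exact ⟨r, ⟨d, hd, fun z => rfl⟩, ⟨d', hd', fun z => rfl⟩, hdP⟩

end IsRectangularTiling

/-! ### The contradiction for almost lined-up tilings. -/

open IsRectangularTiling Rect in
/-- There is no clopen almost lined-up rectangular tiling. -/
theorem not_exists_almost_linedUp_tiling {E : Setoid FZSq} (hE : IsRectangularTiling E)
    (hcl : IsClopenRel E) (hlu : IsAlmostLinedUp E) : False := by
  obtain ⟨k, hk⟩ := hE.exists_isLinedUpTiling hlu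
  obtain ⟨r, hr, hr', hrP⟩ := hE.exists_corner_perm hcl (P := RightOf k)
    (fun _ _ _ => rightOf_translate) (fun y => (hk y).right) (fun y => (hk y).left)
    (fun y R hR S hS S' hS' => (hk y).rightOf_unique hR hS hS')
    (fun y R hR S hS S' hS' => (hk y).leftOf_unique hR hS hS')
  obtain ⟨u, hu, hu', huP⟩ := hE.exists_corner_perm hcl (P := UpOf k)
    (fun _ _ _ => upOf_translate) (fun y => (hk y).up) (fun y => (hk y).down)
    (fun y R hR S hS S' hS' => (hk y).upOf_unique hR hS hS')
    (fun y R hR S hS S' hS' => (hk y).downOf_unique hR hS hS')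
  have hself : ∀ {R : Rect} {z : corners E}, R.a = 0 ∧ R.c = 0 →
      (z : FZSq) = ((R.a, R.c) : ZSq) +ᵥ (z : FZSq) := by
    intro R z h
    rw [h.1, h.2, show ((0, 0) : ZSq) = 0 from rfl, zero_vadd]
  have hcomm : Commute r u := by
    refine Equiv.ext fun z => Subtype.ext ?_
    obtain ⟨R₁, h₁, h0⟩ := z.2
    obtain ⟨R₂, h₂, h12⟩ := (hk z).right R₁ h₁
    obtain ⟨R₃, h₃, h13⟩ := (hk z).up R₁ h₁
    obtain ⟨R₄, h₄, h24⟩ := (hk z).up R₂ h₂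
    obtain ⟨R₅, h₅, h35⟩ := (hk z).right R₃ h₃
    rw [Equiv.Perm.mul_apply, Equiv.Perm.mul_apply,
      hrP z R₃ h₃ R₅ h₅ h35 _ (huP z R₁ h₁ R₃ h₃ h13 z (hself h0)),
      huP z R₂ h₂ R₄ h₄ h24 _ (hrP z R₁ h₁ R₂ h₂ h12 z (hself h0)),
      (hk z).comm h₁ h₂ h₃ h₄ h₅ h12 h13 h24 h35]
  have hfree : IsFreeAction hcomm.zsqAction := by
    refine hcomm.isFreeAction_zsqAction (k := k) (fun z => ?_) (fun z => ?_)
    · obtain ⟨R, hR, h0⟩ := z.2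
      obtain ⟨S, hS, hRS⟩ := (hk z).right R hR
      refine ⟨_, hrP z R hR S hS hRS z (hself h0), ?_⟩
      have := (hk z).width R hR
      have := (hk z).height R hR
      have := (hk z).height S hS
      simp only [RightOf, abs_le] at hRS ⊢
      omega
    · obtain ⟨R, hR, h0⟩ := z.2
      obtain ⟨S, hS, hRS⟩ := (hk z).up R hR
      refine ⟨_, huP z R hR S hS hRS z (hself h0), ?_⟩
      have := (hk z).height R hR
      have := (hk z).width R hR
      have := (hk z).width S hS
      simp only [UpOf, abs_le] at hRS ⊢
      omega
  obtain ⟨φ, hφ, hφv⟩ := hcomm.exists_continuous_cocycle hr hr' hu hu'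
  let _ := hcomm.zsqAction
  have hact : ∀ (g : ZSq) (z : corners E), g +ᵥ z = (r ^ g.1 * u ^ g.2) z := fun _ _ => rfl
  refine not_exists_continuous_free_subaction (isClopen_corners hE hcl)
    (isCompleteSection_corners hE) (isCoCompleteSection_corners hE) ⟨?_, φ, hφ, hφv⟩ hfree
  intro z₁ z₂
  refine ⟨fun ⟨h, hh⟩ => ⟨φ (h, z₁), by rw [← hφv, hh]⟩, ?_⟩
  rintro ⟨g, hg⟩
  -- That the action carries `z₁` to the corner of a tile is invariant under neighbour steps, so it
  -- holds for every tile of the orbit. This gives transitivity.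
  have key : ∀ {P : Rect → Rect → Prop} {s : Equiv.Perm (corners E)} (e : ZSq),
      (∀ z : corners E, e +ᵥ z = s z) →
      (∀ y, ∀ R ∈ tiles E y, ∀ S ∈ tiles E y, P R S →
        ∀ z : corners E, (z : FZSq) = ((R.a, R.c) : ZSq) +ᵥ y →
          (s z : FZSq) = ((S.a, S.c) : ZSq) +ᵥ y) →
      ∀ R ∈ tiles E (z₁ : FZSq), ∀ S ∈ tiles E (z₁ : FZSq), P R S →
        ((∃ h : ZSq, ((h +ᵥ z₁ : corners E) : FZSq) = ((R.a, R.c) : ZSq) +ᵥ (z₁ : FZSq)) ↔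
          ∃ h : ZSq, ((h +ᵥ z₁ : corners E) : FZSq) = ((S.a, S.c) : ZSq) +ᵥ (z₁ : FZSq)) := by
    intro P s e he hs R hR S hS hRS
    constructor
    · rintro ⟨h, hh⟩
      exact ⟨e + h, by rw [add_vadd, he, hs _ R hR S hS hRS _ hh]⟩
    · rintro ⟨h, hh⟩
      refine ⟨-e + h, ?_⟩
      have h1 := hs _ R hR S hS hRS ⟨_, corner_mem_corners hR⟩ rfl
      rw [← hh, ← he] at h1
      rw [add_vadd, ← Subtype.ext h1, neg_vadd_vadd]
  obtain ⟨R, hR, h0⟩ := z₁.2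
  have hall := (hk z₁).forall_of_invariant
    (P := fun R => ∃ h : ZSq, ((h +ᵥ z₁ : corners E) : FZSq) = ((R.a, R.c) : ZSq) +ᵥ (z₁ : FZSq))
    (key (1, 0) (fun z => by simp [hact]) hrP) (key (0, 1) (fun z => by simp [hact]) huP) hR
    ⟨0, by rw [zero_vadd]; exact hself h0⟩
  have hz₂ : g +ᵥ (z₁ : FZSq) ∈ corners E := hg ▸ z₂.2
  obtain ⟨S, hS, ha, hc⟩ := vadd_mem_corners hz₂
  obtain ⟨h, hh⟩ := hall S hS
  refine ⟨h, Subtype.ext ?_⟩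
  change ((h +ᵥ z₁ : corners E) : FZSq) = z₂
  rw [hh, ha, hc, ← hg]

theorem mainTheorem10 :
    (¬ ∃ (M : Set FZSq) (star : AddAction ZSq M),
        IsClopen M ∧ IsCompleteSection ZSq M ∧ IsCoCompleteSection ZSq M ∧
          IsContinuousSubaction (G := ZSq) M star ∧ IsFreeAction star) ∧
      (¬ ∃ E : Setoid FZSq, IsRectangularTiling E ∧ IsClopenRel E ∧ IsAlmostLinedUp E) := by
  refine ⟨?_, ?_⟩
  · rintro ⟨M, star, hM, hc, hcc, hsub, hfree⟩
    exact not_exists_continuous_free_subaction hM hc hcc hsub hfree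
  · rintro ⟨E, hE, hcl, hlu⟩
    exact not_exists_almost_linedUp_tiling hE hcl hlu
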